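/- Let $(X_n,Y_n)$, $n\ge 1$, be iid random vectors in $\mathbb R^2$ with distribution function $F$. Let $a_i(t),b_i(t)$, $i=1,2$, be real functions, with $a_i(t)>0$ for large $t$, such that $$\lim_{t\to\infty}\ \sup_{(x,y)\in\mathbb R^2}\bigl|F^t\bigl(a_1(t)x+b_1(t),\,a_2(t)y+b_2(t)\bigr)-H(x,y)\bigr|=0,\qquad H(x,y)=\exp\bigl(-e^{-x}-e^{-y}\bigr),$$ where $t$ runs through the reals. Let $N(t)$, $t\ge 0$, be random variables with values in $\{0,1,2,\dots\}$ (the number of claims up to time $t$) such that, for every $t$, $N(t)$ is independent of the sequence $((X_n,Y_n))_{n\ge 1}$, and suppose that $N(t)/t\to Z$ in distribution as $t\to\infty$, where $Z>0$ almost surely. For $1\le i\le n$ let $X_{i:n}$ be the $i$-th lowest of $X_1,\dots,X_n$ and $Y_{i:n}$ the $i$-th lowest of $Y_1,\dots,Y_n$, and put $X_{i:n}=Y_{i:n}=0$ if $i\le 0$. For integers $p,q\ge 1$ and real constants $k_{11},\dots,k_{p1}$ and $k_{12},\dots,k_{q2}$ put $$S_1(p,t)=\sum_{j=1}^p k_{j1}X_{N(t)-j+1:N(t)},\qquad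 S_2(q,t)=\sum_{j=1}^q k_{j2}Y_{N(t)-j+1:N(t)},$$ $$c_1=\sum_{j=1}^p k_{j1},\quad c_2=\sum_{j=1}^q k_{j2},\quad \bar k_{li}=\frac1l\sum_{j=1}^l k_{ji},\quad K_m=K-\sum_{l=1}^m\frac1l,$$ where $K$ is Euler's constant. Let $E_{ji}$, $j\ge 1$, $i=1,2$, be iid unit exponential random variables that are independent of $Z$. Then the series $\sum_{j>p}(E_{j1}-1)/j$ and $\sum_{j>q}(E_{j2}-1)/j$ converge almost surely (as limits of their partial sums), and, as $t\to\infty$, $$\left(\frac{S_1(p,t)-b_1(t)c_1}{a_1(t)},\ \frac{S_2(q,t)-b_2(t)c_2}{a_2(t)}\right)$$ converges in distribution to $$\left(\sum_{j=1}^p\bar k_{j1}E_{j1}+c_1\Bigl[\sum_{j=p+1}^\infty\frac{E_{j1}-1}{j}+\ln Z+K_p\Bigr],\ \ \sum_{j=1}^q\bar k_{j2}E_{j2}+c_2\Bigl[\sum_{j=q+1}^\infty\frac{E_{j2}-1}{j}+\ln Z+K_q\Bigr]\right).$$ -/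

import Mathlib

open MeasureTheory ProbabilityTheory Filter Topology
open scoped NNReal

noncomputable section

/-- The `i`-th lowest value `x_{i:n}` (for `1 ≤ i ≤ n`) among the first `n` terms
`x 0, …, x (n - 1)` of the sequence `x`. It is set to `0` when `i` is not in `{1, …, n}`. -/
def orderStat (x : ℕ → ℝ) (n i : ℕ) : ℝ :=
  if h : 1 ≤ i ∧ i ≤ n then
    x (Tuple.sort (fun m : Fin n => x m) ⟨i - 1, by omega⟩)
  else 0

/-- The linear treaty `∑_{j=1}^p k_j x_{n-j+1:n}` on the `p` largest among the first `n` claims.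
Indices are shifted by one: `k j` is the coefficient of the `(j+1)`-th largest claim `x_{n-j:n}`.
A largest claim that does not exist (`j ≥ n`) contributes `0`. -/
def linearTreaty (k : ℕ → ℝ) (p : ℕ) (x : ℕ → ℝ) (n : ℕ) : ℝ :=
  ∑ j ∈ Finset.range p, k j * orderStat x n (n - j)

/-- The sum of the first `l` coefficients. -/
def coeffSum (k : ℕ → ℝ) (l : ℕ) : ℝ := ∑ j ∈ Finset.range l, k j

/-- The running mean of the first `l` coefficients. -/
def runningMean (k : ℕ → ℝ) (l : ℕ) : ℝ := coeffSum k l / l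

/-- The bivariate distribution function of a law on the plane. -/
def bivariateCDF (ν : Measure (ℝ × ℝ)) (z : ℝ × ℝ) : ℝ :=
  ν.real (Set.Iic z.1 ×ˢ Set.Iic z.2)

/-- The bivariate extreme value distribution function with independent unit Gumbel margins. -/
def gumbelProduct (z : ℝ × ℝ) : ℝ := Real.exp (-Real.exp (-z.1) - Real.exp (-z.2))

/-- `F` is in the max-domain of attraction of `H` with norming functions `a₁, a₂` (positive for
large arguments) and `b₁, b₂`: the power `F ^ t` at `(a₁(t) x + b₁(t), a₂(t) y + b₂(t))` converges
to `H (x, y)` uniformly in `(x, y)` as the real number `t` tends to infinity. -/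
def IsInMDA (F H : ℝ × ℝ → ℝ) (a₁ b₁ a₂ b₂ : ℝ → ℝ) : Prop :=
  (∀ᶠ t in atTop, 0 < a₁ t) ∧ (∀ᶠ t in atTop, 0 < a₂ t) ∧
    TendstoUniformly
      (fun (t : ℝ) (z : ℝ × ℝ) => F (a₁ t * z.1 + b₁ t, a₂ t * z.2 + b₂ t) ^ t) H atTop

/-- The partial sum up to index `n` of the series `∑_{j > p} (E_j - 1) / j`.
Indices are shifted by one: `e j` stands for `E_{j+1}`. -/
def tailPartialSum (e : ℕ → ℝ) (p n : ℕ) : ℝ :=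
  ∑ j ∈ Finset.Ico p n, (e j - 1) / ((j : ℝ) + 1)

/-- The sum of the series `∑_{j > p} (E_j - 1) / j`, as the limit of its partial sums
(the series does not converge absolutely). -/
def tailSum (e : ℕ → ℝ) (p : ℕ) : ℝ := limUnder atTop (tailPartialSum e p)

/-- Euler's constant minus the `p`-th harmonic number. -/
def eulerMinusHarmonic (p : ℕ) : ℝ := Real.eulerMascheroniConstant - (harmonic p : ℝ)

/-- `∑_{j ≤ p} k̄_j E_j + c (∑_{j > p} (E_j - 1) / j + ln z + K_p)`, where `c` is the sum of the
first `p` coefficients. Indices are shifted by one: `e j` stands for `E_{j+1}`. -/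
def treatyLimit (k : ℕ → ℝ) (p : ℕ) (e : ℕ → ℝ) (z : ℝ) : ℝ :=
  ∑ j ∈ Finset.range p, runningMean k (j + 1) * e j
    + coeffSum k p * (tailSum e p + Real.log z + eulerMinusHarmonic p)

end

/-! The largest claims are compared with those of an explicit reference sample whose largest values
converge almost surely to the stated limit. The reference sample has size `⌊Z t⌋`. In each component
its points are `-log t + ∑_{j ≤ l < n} E_l / (l + 1)`, Rényi's representation of exponential order
statistics. For fixed `j` and `n = ⌊Z t⌋` this is a partial sum of the centred series plus `log (n /
t) + (H_n - log n) - H_j`, so it tends to `tailSum j + log Z + K_j` (`tendsto_sum_Ico_sub_log`). The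
common random size puts the same `log Z` into both components. The comparison rests on
multiplicative functionals. For a sample of independent size `N`, the expected product of `f₁(x_i)
f₂(y_i)` over the sample is the expectation of the `N`-th power of `b = ∫ f₁ f₂`. If `f₁`, `f₂` are
step functions equal to 1 near `-∞`, then `t (1 - b)` has a limit `L` fixed by the Gumbel tails,
because joint exceedances have probability `o(1/t)`. Since `N(t)/t` tends to `Z`, the expected
product tends to `E exp(-L Z)` (`tendsto_integral_pow_random`). The limit is the same for claims and
reference. With step values `2^(-e)` these products are the monomials in `2^(-count)`, where the
counts are those of exceedances of finitely many levels. By Stone–Weierstrass, all continuous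
functions of these bounded coordinates have asymptotically equal expectations. Counts over a fine
grid determine the truncated largest values up to the mesh, and tightness of the limit removes the
truncation (`SamplePair.tendsto_integral_topStats`). The treaties are linear in the largest values
once `N(t)` is at least `max p q`, an event of probability tending to 1. -/

/-! ### Preliminaries: independence and the unit exponential law -/

/-- Fubini's theorem for a bounded function of two independent random variables. -/
theorem integral_eq_integral_integral_of_indepFun {Ω α β : Type*} [MeasurableSpace Ω]
    [MeasurableSpace α] [MeasurableSpace β] {P : Measure Ω} [IsProbabilityMeasure P]
    {X : Ω → α} {Y : Ω → β} (hX : AEMeasurable X P) (hY : AEMeasurable Y P)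
    (h : IndepFun X Y P) {F : α × β → ℝ} (hF : Measurable F) {C : ℝ} (hC : ∀ z, |F z| ≤ C) :
    ∫ ω, F (X ω, Y ω) ∂P = ∫ ω', ∫ ω, F (X ω, Y ω') ∂P ∂P := by
  have hXp := Measure.isProbabilityMeasure_map hX
  have hYp := Measure.isProbabilityMeasure_map hY
  have h1 := (indepFun_iff_map_prod_eq_prod_map_map hX hY).1 h
  have h2 : ∫ ω, F (X ω, Y ω) ∂P = ∫ z, F z ∂(P.map fun ω => (X ω, Y ω)) :=
    (integral_map (hX.prodMk hY) hF.aestronglyMeasurable).symm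
  have hint : Integrable F ((P.map X).prod (P.map Y)) :=
    Integrable.of_bound hF.aestronglyMeasurable C (ae_of_all _ hC)
  rw [h2, h1, integral_prod_symm _ hint, integral_map hY
    (StronglyMeasurable.aestronglyMeasurable
      (hF.stronglyMeasurable.integral_prod_left' (μ := P.map X)))]
  congr 1 with ω'
  rw [integral_map hX]
  exact (hF.comp (measurable_id.prodMk measurable_const)).aestronglyMeasurable

instance : IsProbabilityMeasure (expMeasure 1) := isProbabilityMeasure_expMeasure one_pos

theorem integral_expMeasure_one (g : ℝ → ℝ) :
    ∫ x, g x ∂(expMeasure 1) = ∫ x in Set.Ioi 0, Real.exp (-x) * g x := by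
  have : expMeasure 1 = volume.withDensity (exponentialPDF 1) := rfl
  rw [this, integral_withDensity_eq_integral_toReal_smul
    (by unfold exponentialPDF; fun_prop) (by simp [exponentialPDF]),
    ← integral_Ici_eq_integral_Ioi, ← integral_indicator measurableSet_Ici]
  congr 1 with x
  rw [exponentialPDF_eq]
  by_cases hx : 0 ≤ x
  · simp [hx, ENNReal.toReal_ofReal, Real.exp_nonneg]
  · simp [hx]

theorem ae_expMeasure_one_nonneg : ∀ᵐ x ∂(expMeasure 1), 0 ≤ x := by
  rw [ae_iff]
  have : expMeasure 1 = volume.withDensity (exponentialPDF 1) := rfl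
  have h2 : {a : ℝ | ¬ 0 ≤ a} = Set.Iio 0 := by ext; simp
  rw [this, h2, withDensity_apply _ measurableSet_Iio,
    lintegral_exponentialPDF_of_nonpos le_rfl]

theorem expMeasure_one_real_Ioi {x : ℝ} (hx : 0 ≤ x) :
    (expMeasure 1).real (Set.Ioi x) = Real.exp (-x) := by
  have h := cdf_expMeasure_eq one_pos x
  rw [cdf_eq_real, if_pos hx] at h
  have h2 := probReal_compl_eq_one_sub (μ := expMeasure 1) (s := Set.Iic x) measurableSet_Iic
  rw [Set.compl_Iic] at h2
  rw [h2, h]; simp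

theorem integrable_pow_expMeasure_one (n : ℕ) :
    Integrable (fun x : ℝ => x ^ n) (expMeasure 1) := by
  have : expMeasure 1 = volume.withDensity (exponentialPDF 1) := rfl
  rw [this, integrable_withDensity_iff_integrable_smul'
    (by unfold exponentialPDF; fun_prop) (by simp [exponentialPDF])]
  have h := (Real.GammaIntegral_convergent (s := n + 1) (by positivity))
  have h3 : IntegrableOn (fun x : ℝ => Real.exp (-x) * x ^ n) (Set.Ici 0) := by
    rw [integrableOn_Ici_iff_integrableOn_Ioi]
    refine h.congr_fun (fun x hx => ?_) measurableSet_Ioi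
    simp
  rw [← integrable_indicator_iff measurableSet_Ici] at h3
  refine h3.congr (ae_of_all _ fun x => ?_)
  simp only [exponentialPDF_eq]
  by_cases hx : 0 ≤ x
  · simp [hx, ENNReal.toReal_ofReal, Real.exp_nonneg]
  · simp [hx]

theorem integral_id_expMeasure_one : ∫ x, x ∂(expMeasure 1) = 1 := by
  rw [integral_expMeasure_one]
  have := Real.Gamma_eq_integral (s := 2) (by norm_num)
  rw [show (2 : ℝ) = 1 + 1 by norm_num, Real.Gamma_add_one (by norm_num), Real.Gamma_one] at this
  rw [← mul_one (1 : ℝ), this]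
  refine setIntegral_congr_fun measurableSet_Ioi fun x hx => ?_
  simp

/-! ### Tail integrals and Rényi's representation -/

/-- The exponentially weighted tail integral of `f`. -/
noncomputable def expTail (f : ℝ → ℝ) (x : ℝ) : ℝ := ∫ y in Set.Ioi x, Real.exp (-y) * f y

section Renyi

variable {f : ℝ → ℝ}

theorem integrableOn_exp_neg_mul (hf : Measurable f) (hb : ∀ x, |f x| ≤ 1) (x : ℝ) :
    IntegrableOn (fun y => Real.exp (-y) * f y) (Set.Ioi x) := by
  refine Integrable.mono' (integrableOn_exp_neg_Ioi x) (by fun_prop) (ae_of_all _ fun y => ?_)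
  rw [Real.norm_eq_abs, abs_mul, Real.abs_exp]
  exact mul_le_of_le_one_right (Real.exp_nonneg _) (hb y)

theorem intervalIntegrable_exp_neg_mul (hf : Measurable f) (hb : ∀ x, |f x| ≤ 1) (a b : ℝ) :
    IntervalIntegrable (fun y => Real.exp (-y) * f y) volume a b :=
  ⟨(integrableOn_exp_neg_mul hf hb a).mono_set Set.Ioc_subset_Ioi_self,
    (integrableOn_exp_neg_mul hf hb b).mono_set Set.Ioc_subset_Ioi_self⟩

theorem expTail_eq_sub (hf : Measurable f) (hb : ∀ x, |f x| ≤ 1) (a x : ℝ) :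
    expTail f x = expTail f a - ∫ y in a..x, Real.exp (-y) * f y := by
  have := intervalIntegral.integral_Ioi_sub_Ioi' (integrableOn_exp_neg_mul hf hb a)
    (integrableOn_exp_neg_mul hf hb x)
  unfold expTail
  linarith

theorem expTail_continuous (hf : Measurable f) (hb : ∀ x, |f x| ≤ 1) :
    Continuous (expTail f) := by
  have : expTail f = fun x => expTail f 0 - ∫ y in (0 : ℝ)..x, Real.exp (-y) * f y := by
    ext x; exact expTail_eq_sub hf hb 0 x
  rw [this]
  exact continuous_const.sub
    (intervalIntegral.continuous_primitive (intervalIntegrable_exp_neg_mul hf hb) 0)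

theorem hasDerivAt_expTail (hf : Measurable f) (hb : ∀ x, |f x| ≤ 1) {x : ℝ}
    (hx : ContinuousAt f x) : HasDerivAt (expTail f) (-(Real.exp (-x) * f x)) x := by
  have : expTail f = fun x => expTail f 0 - ∫ y in (0 : ℝ)..x, Real.exp (-y) * f y := by
    ext x; exact expTail_eq_sub hf hb 0 x
  rw [this]
  refine (intervalIntegral.integral_hasDerivAt_right (intervalIntegrable_exp_neg_mul hf hb 0 x)
    ?_ ?_).const_sub _
  · exact (StronglyMeasurable.stronglyMeasurableAtFilter (by fun_prop))
  · fun_prop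

theorem abs_expTail_le (hb : ∀ x, |f x| ≤ 1) (x : ℝ) :
    |expTail f x| ≤ Real.exp (-x) := by
  rw [← integral_exp_neg_Ioi, ← Real.norm_eq_abs]
  refine norm_integral_le_of_norm_le (integrableOn_exp_neg_Ioi x) (ae_of_all _ fun y => ?_)
  rw [Real.norm_eq_abs, abs_mul, Real.abs_exp]
  exact mul_le_of_le_one_right (Real.exp_nonneg _) (hb y)

theorem tendsto_expTail (hb : ∀ x, |f x| ≤ 1) :
    Tendsto (expTail f) atTop (𝓝 0) :=
  squeeze_zero_norm (abs_expTail_le hb)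
    (Real.tendsto_exp_atBot.comp tendsto_neg_atTop_atBot)

/-- The integrand is the derivative of `-expTail f ^ (n + 1)` wherever `f` is continuous. The
fundamental theorem of calculus tolerates the countable exceptional set because `expTail f` is
continuous, and the boundary term at infinity vanishes. -/
theorem integral_Ioi_expTail_pow (hf : Measurable f) (hb : ∀ x, |f x| ≤ 1)
    (hc : {x | ¬ ContinuousAt f x}.Countable) (n : ℕ) (x : ℝ) :
    ∫ u in Set.Ioi x, (n + 1 : ℝ) * (Real.exp (-u) * f u) * expTail f u ^ n
      = expTail f x ^ (n + 1) := by
  have hmeas : Measurable (expTail f) := (expTail_continuous hf hb).measurable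
  have hint : IntegrableOn
      (fun u => (n + 1 : ℝ) * (Real.exp (-u) * f u) * expTail f u ^ n) (Set.Ioi x) := by
    have h1 := ((integrableOn_exp_neg_mul hf hb x).const_mul (n + 1 : ℝ))
    refine Integrable.mul_bdd h1 (c := Real.exp (-x) ^ n) (by fun_prop) ?_
    filter_upwards [ae_restrict_mem measurableSet_Ioi] with u hu
    rw [norm_pow]
    refine pow_le_pow_left₀ (norm_nonneg _) ((abs_expTail_le hb u).trans ?_) n
    exact Real.exp_le_exp.2 (neg_le_neg (le_of_lt hu))
  have h1 := intervalIntegral_tendsto_integral_Ioi x hint tendsto_id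
  have h2 : Tendsto (fun T => expTail f x ^ (n + 1) - expTail f T ^ (n + 1)) atTop
      (𝓝 (expTail f x ^ (n + 1) - 0 ^ (n + 1))) :=
    ((tendsto_expTail hb).pow _).const_sub _
  rw [zero_pow (by omega), sub_zero] at h2
  refine tendsto_nhds_unique h1 (h2.congr' ?_)
  filter_upwards [eventually_ge_atTop x] with T hT
  have := integral_eq_of_hasDerivAt_off_countable_of_le (fun u => - expTail f u ^ (n + 1))
    (fun u => (n + 1 : ℝ) * (Real.exp (-u) * f u) * expTail f u ^ n) hT hc
    ((expTail_continuous hf hb).pow _).neg.continuousOn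
    (fun u hu => by
      have h := ((hasDerivAt_expTail hf hb (by simpa using hu.2)).pow (n + 1)).neg
      refine h.congr_deriv ?_
      push_cast
      ring)
    ((intervalIntegrable_iff_integrableOn_Ioc_of_le hT).2
      (hint.mono_set Set.Ioc_subset_Ioi_self))
  simp only [id, this]
  ring

theorem integral_comp_add_expMeasure_one (x : ℝ) :
    ∫ y, f (x + y) ∂(expMeasure 1) = Real.exp x * expTail f x := by
  rw [integral_expMeasure_one, expTail, ← integral_const_mul]
  have := (measurePreserving_add_left volume x).setIntegral_preimage_emb
    (measurableEmbedding_addLeft x) (fun y => Real.exp x * (Real.exp (-y) * f y)) (Set.Ioi x)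
  rw [← this]
  have h2 : (fun y => x + y) ⁻¹' Set.Ioi x = Set.Ioi 0 := by ext; simp
  rw [h2]
  congr 1 with y
  rw [← mul_assoc, ← Real.exp_add]
  congr 2; ring

/-- This is the memoryless property in integral form: `y / (n + 1)` has the law of the minimum of `n
+ 1` unit exponentials, and beyond the minimum the other `n` start afresh. The substitution `u = x +
y / (n + 1)` reduces it to `integral_Ioi_expTail_pow`. -/
theorem integral_scaled_expMeasure_one (hf : Measurable f) (hb : ∀ x, |f x| ≤ 1)
    (hc : {x | ¬ ContinuousAt f x}.Countable) (n : ℕ) (x : ℝ) :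
    ∫ y, f (x + y / (n + 1)) * (∫ z, f (x + y / (n + 1) + z) ∂(expMeasure 1)) ^ n
        ∂(expMeasure 1)
      = (∫ y, f (x + y) ∂(expMeasure 1)) ^ (n + 1) := by
  simp_rw [integral_comp_add_expMeasure_one]
  rw [mul_pow, ← integral_Ioi_expTail_pow hf hb hc, integral_expMeasure_one]
  have hn : (0 : ℝ) < n + 1 := by positivity
  have h1 := integral_comp_mul_left_Ioi (fun y => Real.exp (-y) * (f (x + y / (n + 1)) *
    (Real.exp (x + y / (n + 1)) * expTail f (x + y / (n + 1))) ^ n)) 0 hn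
  rw [mul_zero, smul_eq_mul, eq_inv_mul_iff_mul_eq₀ hn.ne'] at h1
  rw [← h1, ← integral_const_mul, ← integral_const_mul]
  have := (measurePreserving_add_left volume x).setIntegral_preimage_emb
    (measurableEmbedding_addLeft x) (fun u => Real.exp x ^ (n + 1) *
      ((n + 1 : ℝ) * (Real.exp (-u) * f u) * expTail f u ^ n)) (Set.Ioi x)
  rw [← this]
  have h2 : (fun y => x + y) ⁻¹' Set.Ioi x = Set.Ioi 0 := by ext; simp
  rw [h2]
  congr 1 with y
  rw [mul_div_cancel_left₀ _ hn.ne', mul_pow]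
  have h3 : Real.exp (-((n + 1 : ℝ) * y)) * Real.exp (x + y) ^ n
      = Real.exp x ^ (n + 1) * Real.exp (-(x + y)) := by
    rw [← Real.exp_nat_mul, ← Real.exp_nat_mul, ← Real.exp_add, ← Real.exp_add]
    congr 1; push_cast; ring
  linear_combination (n + 1 : ℝ) * f (x + y) * expTail f (x + y) ^ n * h3

/-- Padding with zeros keeps the prefix in `ℕ → ℝ` for every `n`, so the Fubini lemma applies
without dependent index types. -/
theorem indepFun_prefix {Ω : Type*} [MeasurableSpace Ω] {P : Measure Ω} {e : ℕ → Ω → ℝ}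
    (hm : ∀ i, AEMeasurable (e i) P) (hi : iIndepFun e P) (n : ℕ) :
    IndepFun (fun ω l => if l < n then e l ω else 0) (e n) P := by
  have h := hi.indepFun_finset₀ (Finset.range n) {n} (by simp) hm
  have hφ : Measurable fun (a : Finset.range n → ℝ) (l : ℕ) =>
      if h : l < n then a ⟨l, Finset.mem_range.2 h⟩ else 0 :=
    measurable_pi_lambda _ fun l => by
      by_cases h : l < n
      · simp only [h, dite_true]; fun_prop
      · simp only [h, dite_false]; fun_prop
  have hψ : Measurable fun b : ({n} : Finset ℕ) → ℝ => b ⟨n, Finset.mem_singleton_self n⟩ :=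
    measurable_pi_apply _
  exact h.comp hφ hψ

/-- **Rényi's representation**: for iid unit exponential `e`, the points
`∑_{j ≤ l < n} e_l / (l + 1)`, `j < n`, are distributed as an iid unit exponential sample of size
`n`, in the sense that multiplicative functionals have the same expectation. -/
theorem integral_prod_renyi {Ω : Type*} [MeasurableSpace Ω] {P : Measure Ω}
    [IsProbabilityMeasure P] {e : ℕ → Ω → ℝ} (he : ∀ i, HasLaw (e i) (expMeasure 1) P)
    (hi : iIndepFun e P) (hf : Measurable f) (hb : ∀ x, |f x| ≤ 1)
    (hc : {x | ¬ ContinuousAt f x}.Countable) (n : ℕ) (x : ℝ) :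
    ∫ ω, ∏ j ∈ Finset.range n, f (x + ∑ l ∈ Finset.Ico j n, e l ω / (l + 1)) ∂P
      = (∫ y, f (x + y) ∂(expMeasure 1)) ^ n := by
  have hm : ∀ i, AEMeasurable (e i) P := fun i => (he i).aemeasurable
  induction n generalizing x with
  | zero => simp
  | succ n ih =>
    -- The summand `e n / (n + 1)` occurs in all `n + 1` partial sums. Splitting it off shifts the
    -- base point `x` and leaves the product for `n`, to which the induction hypothesis applies.
    let F : (ℕ → ℝ) × ℝ → ℝ := fun z => f (x + z.2 / (n + 1)) *
      ∏ j ∈ Finset.range n, f (x + z.2 / (n + 1) + ∑ l ∈ Finset.Ico j n, z.1 l / (l + 1))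
    have hF : Measurable F := by fun_prop
    have hFb : ∀ z, |F z| ≤ 1 := fun z => by
      simp only [F]
      rw [abs_mul, Finset.abs_prod]
      exact mul_le_one₀ (hb _) (by positivity) (Finset.prod_le_one (fun _ _ => abs_nonneg _)
        fun _ _ => hb _)
    have hpre : AEMeasurable (fun ω (l : ℕ) => if l < n then e l ω else 0) P :=
      aemeasurable_pi_lambda _ fun l => by
        by_cases h : l < n
        · simpa only [h, if_true] using hm l
        · simp only [h, if_false]; fun_prop
    have key := integral_eq_integral_integral_of_indepFun hpre (hm n) (indepFun_prefix hm hi n)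
      hF hFb
    have e1 : ∀ ω ω' : Ω, F (fun l => if l < n then e l ω else 0, e n ω')
        = f (x + e n ω' / (n + 1)) * ∏ j ∈ Finset.range n, f (x + e n ω' / (n + 1) +
          ∑ l ∈ Finset.Ico j n, e l ω / (l + 1)) := by
      intro ω ω'
      simp only [F]
      congr 1
      refine Finset.prod_congr rfl fun j _ => ?_
      congr 2
      refine Finset.sum_congr rfl fun l hl => ?_
      rw [if_pos (Finset.mem_Ico.1 hl).2]
    have e2 : ∀ ω, ∏ j ∈ Finset.range (n + 1),
        f (x + ∑ l ∈ Finset.Ico j (n + 1), e l ω / (l + 1))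
          = F (fun l => if l < n then e l ω else 0, e n ω) := by
      intro ω
      rw [e1, Finset.prod_range_succ, mul_comm]
      congr 1
      · simp
      · refine Finset.prod_congr rfl fun j hj => ?_
        rw [Finset.sum_Ico_succ_top (Finset.mem_range.1 hj).le]
        congr 1; ring
    simp_rw [e2]
    rw [key]
    simp_rw [e1, integral_const_mul, ih]
    rw [← integral_scaled_expMeasure_one hf hb hc n x, ← (he n).map_eq, integral_map (hm n)]
    have hG : Measurable fun x : ℝ => ∫ z, f (x + z) ∂(expMeasure 1) := by
      have : (fun x : ℝ => ∫ z, f (x + z) ∂(expMeasure 1))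
          = fun x => Real.exp x * expTail f x := by
        ext x; exact integral_comp_add_expMeasure_one x
      rw [this]
      have := (expTail_continuous hf hb).measurable
      fun_prop
    rw [(he n).map_eq]
    have hs : Measurable fun y : ℝ => x + y / (n + 1) := by fun_prop
    exact ((hf.comp hs).mul ((hG.comp hs).pow_const n)).aestronglyMeasurable

end Renyi

/-! ### Order statistics through exceedance counts -/

/-- The number of `i < n` such that `x i` exceeds `a`. -/
noncomputable def exceedCount (x : ℕ → ℝ) (n : ℕ) (a : ℝ) : ℕ := {i ∈ Finset.range n | a < x i}.card

theorem exceedCount_eq_card_fin (x : ℕ → ℝ) (n : ℕ) (a : ℝ) :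
    exceedCount x n a = {i : Fin n | a < x i}.toFinset.card := by
  unfold exceedCount
  symm
  refine Finset.card_bij (fun i _ => (i : ℕ)) ?_ ?_ ?_
  · intro i hi; simpa using hi
  · intro i _ j _ h; exact Fin.ext h
  · intro i hi
    simp only [Finset.mem_filter, Finset.mem_range] at hi
    exact ⟨⟨i, hi.1⟩, by simpa using hi.2, rfl⟩

/-- Sorting does not change the count, and in sorted order the indices exceeding `a` form an upper
set; it contains the zero-based index `n - j - 1` exactly when it has at least `j + 1` elements. The
later facts on order statistics reduce to counts through this equivalence. -/
theorem lt_orderStat_iff (x : ℕ → ℝ) {n j : ℕ} (hj : j < n) (a : ℝ) :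
    a < orderStat x n (n - j) ↔ j + 1 ≤ exceedCount x n a := by
  set s := Tuple.sort (fun m : Fin n => x m) with hs
  have hmono : Monotone fun m : Fin n => x (s m) := Tuple.monotone_sort (fun m : Fin n => x m)
  have hcard : exceedCount x n a = (Finset.univ.filter fun m : Fin n => a < x (s m)).card := by
    rw [exceedCount_eq_card_fin]
    symm
    refine Finset.card_bij (fun i _ => s i) ?_ ?_ ?_
    · intro i hi; simpa using hi
    · intro i _ j _ h; exact s.injective h
    · intro i hi
      exact ⟨s.symm i, by simpa using hi, by simp⟩
  have hord : orderStat x n (n - j) = x (s ⟨n - j - 1, by omega⟩) := by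
    unfold orderStat
    rw [dif_pos ⟨by omega, by omega⟩]
  rw [hord, hcard]
  constructor
  · intro h
    have : Finset.Ici (⟨n - j - 1, by omega⟩ : Fin n) ⊆
        Finset.univ.filter fun m : Fin n => a < x (s m) := by
      intro m hm
      simp only [Finset.mem_filter, Finset.mem_univ, true_and]
      exact h.trans_le (hmono (Finset.mem_Ici.1 hm))
    have := Finset.card_le_card this
    rw [Fin.card_Ici] at this
    simp only at this
    omega
  · intro h
    by_contra hlt
    have : (Finset.univ.filter fun m : Fin n => a < x (s m)) ⊆
        Finset.Ioi (⟨n - j - 1, by omega⟩ : Fin n) := by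
      intro m hm
      simp only [Finset.mem_filter, Finset.mem_univ, true_and] at hm
      rw [Finset.mem_Ioi]
      by_contra hle
      exact hlt (hm.trans_le (hmono (not_lt.1 hle)))
    have := Finset.card_le_card this
    rw [Fin.card_Ioi] at this
    simp only at this
    omega

theorem orderStat_affine (x : ℕ → ℝ) {n j : ℕ} (hj : j < n) {a : ℝ} (ha : 0 < a) (b : ℝ) :
    orderStat (fun i => (x i - b) / a) n (n - j) = (orderStat x n (n - j) - b) / a := by
  refine eq_of_forall_lt_iff fun c => ?_
  rw [lt_orderStat_iff _ hj, lt_div_iff₀ ha, lt_sub_iff_add_lt, lt_orderStat_iff _ hj]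
  simp only [exceedCount, lt_div_iff₀ ha, lt_sub_iff_add_lt]

theorem orderStat_of_antitone {x : ℕ → ℝ} {n j : ℕ} (hj : j < n)
    (hx : ∀ i k, i ≤ k → k < n → x k ≤ x i) : orderStat x n (n - j) = x j := by
  refine eq_of_forall_lt_iff fun c => ?_
  rw [lt_orderStat_iff _ hj, exceedCount]
  constructor
  · intro h
    by_contra hlt
    have : {i ∈ Finset.range n | c < x i} ⊆ Finset.range j := by
      intro i hi
      simp only [Finset.mem_filter, Finset.mem_range] at hi ⊢
      by_contra hji
      exact hlt (hi.2.trans_le (hx j i (not_lt.1 hji) hi.1))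
    have := Finset.card_le_card this
    rw [Finset.card_range] at this
    omega
  · intro h
    have : Finset.range (j + 1) ⊆ {i ∈ Finset.range n | c < x i} := by
      intro i hi
      simp only [Finset.mem_filter, Finset.mem_range] at hi ⊢
      exact ⟨by omega, h.trans_le (hx i j (by omega) hj)⟩
    have := Finset.card_le_card this
    rwa [Finset.card_range] at this

theorem measurable_exceedCount (n : ℕ) (a : ℝ) :
    Measurable fun x : ℕ → ℝ => exceedCount x n a := by
  simp only [exceedCount, Finset.card_filter]
  refine Finset.measurable_sum _ fun i _ => Measurable.ite ?_ measurable_const measurable_const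
  exact measurableSet_lt measurable_const (measurable_pi_apply i)

theorem measurable_orderStat_sub (n j : ℕ) :
    Measurable fun x : ℕ → ℝ => orderStat x n (n - j) := by
  by_cases hj : j < n
  · refine measurable_of_Ioi fun a => ?_
    have : (fun x : ℕ → ℝ => orderStat x n (n - j)) ⁻¹' Set.Ioi a
        = (fun x => exceedCount x n a) ⁻¹' Set.Ici (j + 1) := by
      ext x; simpa using lt_orderStat_iff x hj a
    rw [this]
    exact measurable_exceedCount n a measurableSet_Ici
  -- For `j ≥ n` truncated subtraction gives the index 0, which is out of range, so the default
  -- value 0 is taken.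
  · have : (fun x : ℕ → ℝ => orderStat x n (n - j)) = fun _ => 0 := by
      ext x
      unfold orderStat
      rw [dif_neg (by omega)]
    rw [this]; exact measurable_const

/-! ### Level weights and their expansion in half-line indicators -/

/-- The step function equal to the product of the `(1/2) ^ e k` over the levels `x k` below the
argument. -/
noncomputable def levelWeight {m : ℕ} (x : Fin m → ℝ) (e : Fin m → ℕ) (y : ℝ) : ℝ :=
  ∏ k, if x k < y then (1 / 2 : ℝ) ^ e k else 1

section LevelWeight

variable {m : ℕ} (x : Fin m → ℝ) (e : Fin m → ℕ)

theorem measurable_levelWeight : Measurable (levelWeight x e) :=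
  Finset.measurable_fun_prod _ fun _ _ => Measurable.ite measurableSet_Ioi measurable_const
    measurable_const

theorem levelWeight_nonneg (y : ℝ) : 0 ≤ levelWeight x e y :=
  Finset.prod_nonneg fun k _ => by split_ifs <;> positivity

theorem levelWeight_le_one (y : ℝ) : levelWeight x e y ≤ 1 :=
  Finset.prod_le_one (fun k _ => by split_ifs <;> positivity) fun k _ => by
    split_ifs
    · exact pow_le_one₀ (by norm_num) (by norm_num)
    · exact le_rfl

theorem abs_levelWeight_le_one (y : ℝ) : |levelWeight x e y| ≤ 1 := by
  rw [abs_of_nonneg (levelWeight_nonneg x e y)]; exact levelWeight_le_one x e y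

theorem exists_levelWeight_eq_one : ∃ a, ∀ y ≤ a, levelWeight x e y = 1 := by
  obtain ⟨a, ha⟩ := (Set.finite_range x).bddBelow
  refine ⟨a, fun y hy => Finset.prod_eq_one fun k _ => if_neg ?_⟩
  exact not_lt.2 (hy.trans (ha ⟨k, rfl⟩))

theorem countable_not_continuousAt_levelWeight :
    {y | ¬ ContinuousAt (levelWeight x e) y}.Countable := by
  refine (Set.finite_range x).countable.mono fun y hy => ?_
  by_contra hy'
  refine hy ?_
  have : ∀ k, ContinuousAt (fun y => if x k < y then (1 / 2 : ℝ) ^ e k else 1) y := by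
    intro k
    rcases lt_trichotomy (x k) y with h | h | h
    · refine (continuousAt_const (y := (1 / 2 : ℝ) ^ e k)).congr ?_
      filter_upwards [Ioi_mem_nhds h] with z hz
      rw [if_pos (Set.mem_Ioi.1 hz)]
    · exact absurd ⟨k, h⟩ hy'
    · refine (continuousAt_const (y := (1 : ℝ))).congr ?_
      filter_upwards [Iio_mem_nhds h] with z hz
      rw [if_neg (not_lt.2 (le_of_lt hz))]
  unfold levelWeight
  exact tendsto_finsetProd _ fun k _ => this k

/-- Exchanging the two products turns a monomial in `2 ^ (-count)` into a product over the sample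
elements, whose expectation factorises for iid samples. -/
theorem prod_pow_half_exceedCount (ξ : ℕ → ℝ) (n : ℕ) :
    ∏ k, ((1 / 2 : ℝ) ^ exceedCount ξ n (x k)) ^ e k
      = ∏ i ∈ Finset.range n, levelWeight x e (ξ i) := by
  unfold levelWeight
  rw [Finset.prod_comm]
  refine Finset.prod_congr rfl fun k _ => ?_
  rw [Finset.prod_ite, Finset.prod_const, Finset.prod_const_one, mul_one, ← pow_mul, ← pow_mul,
    mul_comm]
  rfl

/-- The linear span of the indicator functions of upper half-lines. -/
def ioiSpan : Submodule ℝ (ℝ → ℝ) :=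
  Submodule.span ℝ (Set.range fun a : ℝ => (Set.Ioi a).indicator 1)

theorem mul_indicator_mem_ioiSpan {g : ℝ → ℝ} (hg : g ∈ ioiSpan) (a : ℝ) :
    g * (Set.Ioi a).indicator 1 ∈ ioiSpan := by
  induction hg using Submodule.span_induction with
  | mem g hg =>
    obtain ⟨b, rfl⟩ := hg
    refine Submodule.subset_span ⟨max b a, ?_⟩
    simp only
    rw [← Set.Ioi_inter_Ioi, Set.inter_indicator_one]
  | zero => simp
  | add g h _ _ ihg ihh => rw [add_mul]; exact add_mem ihg ihh
  | smul c g _ ih => rw [smul_mul_assoc]; exact Submodule.smul_mem _ _ ih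

/-- Weights are 1 near `-∞` and so do not lie in the span themselves. Subtracting from 1 reduces
them to half-line indicators, whose integrals are the tail probabilities. -/
theorem one_sub_levelWeight_mem_ioiSpan : 1 - levelWeight x e ∈ ioiSpan := by
  have key : ∀ s : Finset (Fin m),
      (1 - fun y => ∏ k ∈ s, if x k < y then (1 / 2 : ℝ) ^ e k else 1) ∈ ioiSpan := by
    intro s
    induction s using Finset.induction_on with
    | empty =>
      convert zero_mem ioiSpan
      ext y; simp
    | insert k s hk ih =>
      set g : ℝ → ℝ := 1 - fun y => ∏ k ∈ s, if x k < y then (1 / 2 : ℝ) ^ e k else 1 with hg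
      have h1 : (Set.Ioi (x k)).indicator (1 : ℝ → ℝ) ∈ ioiSpan :=
        Submodule.subset_span ⟨x k, rfl⟩
      have h2 := mul_indicator_mem_ioiSpan ih (x k)
      -- With `g = 1 - W`, multiplying `W` by the factor of level `x k` turns `g` into `g + (1 -
      -- 2^(-e k)) (1_I - g 1_I)`, where `I` is the half-line above `x k`.
      have h3 := add_mem ih (Submodule.smul_mem _ (1 - (1 / 2 : ℝ) ^ e k) (sub_mem h1 h2))
      convert h3 using 1
      ext y
      simp only [Pi.sub_apply, Pi.add_apply, Pi.smul_apply, Pi.mul_apply, Pi.one_apply,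
        Finset.prod_insert hk, Set.indicator_apply, Set.mem_Ioi, smul_eq_mul, hg]
      split_ifs <;> ring
  exact key Finset.univ

end LevelWeight

theorem measurable_of_mem_ioiSpan {g : ℝ → ℝ} (hg : g ∈ ioiSpan) : Measurable g := by
  induction hg using Submodule.span_induction with
  | mem g hg =>
    obtain ⟨b, rfl⟩ := hg
    exact measurable_one.indicator measurableSet_Ioi
  | zero => exact measurable_zero
  | add g h _ _ ihg ihh => exact ihg.add ihh
  | smul c g _ ih => exact ih.const_smul c

theorem integrable_of_mem_ioiSpan {g : ℝ → ℝ} (hg : g ∈ ioiSpan) (ρ : Measure ℝ)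
    [IsFiniteMeasure ρ] : Integrable g ρ := by
  induction hg using Submodule.span_induction with
  | mem g hg =>
    obtain ⟨b, rfl⟩ := hg
    exact (integrable_const (1 : ℝ)).indicator measurableSet_Ioi
  | zero => exact integrable_zero _ _ _
  | add g h _ _ ihg ihh => exact ihg.add ihh
  | smul c g _ ih => exact ih.smul c

/-- The order of quantifiers matters: `L` depends on `g` alone and serves every family `ρ` with
Gumbel tails. The generators satisfy this by hypothesis on `ρ`, and linearity extends it to the
span. -/
theorem exists_tendsto_mul_integral {g : ℝ → ℝ} (hg : g ∈ ioiSpan) :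
    ∃ L : ℝ, ∀ ρ : ℝ≥0 → Measure ℝ, (∀ t, IsProbabilityMeasure (ρ t)) →
      (∀ x, Tendsto (fun t : ℝ≥0 => (t : ℝ) * (ρ t).real (Set.Ioi x)) atTop
        (𝓝 (Real.exp (-x)))) →
      Tendsto (fun t : ℝ≥0 => (t : ℝ) * ∫ y, g y ∂(ρ t)) atTop (𝓝 L) := by
  induction hg using Submodule.span_induction with
  | mem g hg =>
    obtain ⟨b, rfl⟩ := hg
    refine ⟨Real.exp (-b), fun ρ hρ h => ?_⟩
    simpa [integral_indicator_one measurableSet_Ioi] using h b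
  | zero => exact ⟨0, fun ρ hρ h => by simp⟩
  | add g h hg hh ihg ihh =>
    obtain ⟨L, hL⟩ := ihg
    obtain ⟨M, hM⟩ := ihh
    refine ⟨L + M, fun ρ hρ hx => ((hL ρ hρ hx).add (hM ρ hρ hx)).congr fun t => ?_⟩
    have := hρ t
    simp only [Pi.add_apply]
    rw [integral_add (integrable_of_mem_ioiSpan hg _) (integrable_of_mem_ioiSpan hh _), mul_add]
  | smul c g hg ih =>
    obtain ⟨L, hL⟩ := ih
    refine ⟨c * L, fun ρ hρ hx => ((hL ρ hρ hx).const_mul c).congr fun t => ?_⟩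
    simp only [Pi.smul_apply, smul_eq_mul]
    rw [integral_const_mul]; ring

/-! ### Gumbel tails with asymptotic independence -/

/-- The probability measures `ν t` on the plane have asymptotically independent margins with
Gumbel tails. -/
structure HasGumbelTails (ν : ℝ≥0 → Measure (ℝ × ℝ)) : Prop where
  isProbabilityMeasure : ∀ t, IsProbabilityMeasure (ν t)
  fst : ∀ x, Tendsto (fun t : ℝ≥0 => (t : ℝ) * (ν t).real (Prod.fst ⁻¹' Set.Ioi x)) atTop
    (𝓝 (Real.exp (-x)))
  snd : ∀ x, Tendsto (fun t : ℝ≥0 => (t : ℝ) * (ν t).real (Prod.snd ⁻¹' Set.Ioi x)) atTop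
    (𝓝 (Real.exp (-x)))
  prod : ∀ x y, Tendsto (fun t : ℝ≥0 => (t : ℝ) * (ν t).real (Set.Ioi x ×ˢ Set.Ioi y)) atTop
    (𝓝 0)

/-- The expansion `1 - f₁ f₂ = (1 - f₁) + (1 - f₂) - (1 - f₁)(1 - f₂)` leaves two marginal terms.
The last term vanishes unless both coordinates exceed fixed levels, so it contributes 0 in the
limit. Again one `L` serves all families `ν`. -/
theorem exists_tendsto_mul_one_sub_integral {m : ℕ} (x : Fin m → ℝ) (e₁ e₂ : Fin m → ℕ) :
    ∃ L : ℝ, ∀ ν : ℝ≥0 → Measure (ℝ × ℝ), HasGumbelTails ν →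
      Tendsto (fun t : ℝ≥0 => (t : ℝ) *
        (1 - ∫ z, levelWeight x e₁ z.1 * levelWeight x e₂ z.2 ∂(ν t))) atTop (𝓝 L) := by
  have hs₁ := one_sub_levelWeight_mem_ioiSpan x e₁
  have hs₂ := one_sub_levelWeight_mem_ioiSpan x e₂
  obtain ⟨L₁, hL₁⟩ := exists_tendsto_mul_integral hs₁
  obtain ⟨L₂, hL₂⟩ := exists_tendsto_mul_integral hs₂
  obtain ⟨a, ha⟩ := exists_levelWeight_eq_one x e₁
  obtain ⟨b, hb⟩ := exists_levelWeight_eq_one x e₂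
  refine ⟨L₁ + L₂ - 0, fun ν hν => ?_⟩
  have hpr := hν.isProbabilityMeasure
  have h1 := hL₁ (fun t => (ν t).map Prod.fst)
    (fun t => Measure.isProbabilityMeasure_map measurable_fst.aemeasurable) (fun x => by
      refine (hν.fst x).congr fun t => ?_
      rw [map_measureReal_apply measurable_fst measurableSet_Ioi])
  have h2 := hL₂ (fun t => (ν t).map Prod.snd)
    (fun t => Measure.isProbabilityMeasure_map measurable_snd.aemeasurable) (fun x => by
      refine (hν.snd x).congr fun t => ?_
      rw [map_measureReal_apply measurable_snd measurableSet_Ioi])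
  set f₁ := levelWeight x e₁
  set f₂ := levelWeight x e₂
  have hm₁ : Measurable f₁ := measurable_levelWeight x e₁
  have hm₂ : Measurable f₂ := measurable_levelWeight x e₂
  have hb₁ : ∀ y, |1 - f₁ y| ≤ 1 := fun y => abs_le.2
    ⟨by linarith [levelWeight_le_one x e₁ y], by linarith [levelWeight_nonneg x e₁ y]⟩
  have hb₂ : ∀ y, |1 - f₂ y| ≤ 1 := fun y => abs_le.2
    ⟨by linarith [levelWeight_le_one x e₂ y], by linarith [levelWeight_nonneg x e₂ y]⟩
  have h3 : Tendsto (fun t : ℝ≥0 => (t : ℝ) * ∫ z, (1 - f₁ z.1) * (1 - f₂ z.2) ∂(ν t)) atTop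
      (𝓝 0) := by
    refine squeeze_zero_norm (fun t => ?_) (hν.prod a b)
    rw [norm_mul, Real.norm_of_nonneg t.coe_nonneg]
    refine mul_le_mul_of_nonneg_left ?_ t.coe_nonneg
    rw [← integral_indicator_one (measurableSet_Ioi.prod measurableSet_Ioi)]
    refine norm_integral_le_of_norm_le ((integrable_const (1 : ℝ)).indicator
      (measurableSet_Ioi.prod measurableSet_Ioi)) (ae_of_all _ fun z => ?_)
    rw [Real.norm_eq_abs, abs_mul]
    by_cases hz : z ∈ Set.Ioi a ×ˢ Set.Ioi b
    · rw [Set.indicator_of_mem hz]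
      exact mul_le_one₀ (hb₁ _) (abs_nonneg _) (hb₂ _)
    · rw [Set.indicator_of_notMem hz]
      rw [Set.mem_prod, not_and_or, Set.mem_Ioi, Set.mem_Ioi, not_lt, not_lt] at hz
      rcases hz with hz | hz
      · simp [ha _ hz]
      · simp [hb _ hz]
  refine ((h1.add h2).sub h3).congr fun t => ?_
  rw [integral_map measurable_fst.aemeasurable (measurable_of_mem_ioiSpan hs₁).aestronglyMeasurable,
    integral_map measurable_snd.aemeasurable (measurable_of_mem_ioiSpan hs₂).aestronglyMeasurable]
  have i1 : Integrable (fun z : ℝ × ℝ => (1 - f₁) z.1) (ν t) :=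
    Integrable.of_bound ((measurable_of_mem_ioiSpan hs₁).comp measurable_fst).aestronglyMeasurable 1
      (ae_of_all _ fun z => by simpa using hb₁ z.1)
  have i2 : Integrable (fun z : ℝ × ℝ => (1 - f₂) z.2) (ν t) :=
    Integrable.of_bound ((measurable_of_mem_ioiSpan hs₂).comp measurable_snd).aestronglyMeasurable 1
      (ae_of_all _ fun z => by simpa using hb₂ z.2)
  have i3 : Integrable (fun z : ℝ × ℝ => (1 - f₁ z.1) * (1 - f₂ z.2)) (ν t) :=
    Integrable.of_bound (by fun_prop) 1 (ae_of_all _ fun z => by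
      rw [Real.norm_eq_abs, abs_mul]; exact mul_le_one₀ (hb₁ _) (abs_nonneg _) (hb₂ _))
  have i4 : Integrable (fun z : ℝ × ℝ => f₁ z.1 * f₂ z.2) (ν t) :=
    Integrable.of_bound (by fun_prop) 1 (ae_of_all _ fun z => by
      rw [Real.norm_eq_abs, abs_mul]
      exact mul_le_one₀ (abs_levelWeight_le_one _ _ _) (abs_nonneg _)
        (abs_levelWeight_le_one _ _ _))
  rw [← mul_add, ← mul_sub]
  congr 1
  have i5 : 1 - ∫ z, f₁ z.1 * f₂ z.2 ∂(ν t) = ∫ z, (1 - f₁ z.1 * f₂ z.2) ∂(ν t) := by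
    rw [integral_sub (integrable_const _) i4]; simp
  rw [i5, ← integral_add i1 i2]
  refine (integral_sub (i1.add i2) i3).symm.trans (integral_congr_ae (ae_of_all _ fun z => ?_))
  simp only [Pi.add_apply, Pi.sub_apply, Pi.one_apply]
  ring

/-- Taking logarithms gives `t log p → log h`, hence `p → 1`. The inequalities `1 - 1/p ≤ log p ≤ p
- 1` then trap `t (1 - p)` between `-t p log p` and `-t log p`. -/
theorem tendsto_mul_one_sub_of_tendsto_rpow {p : ℝ≥0 → ℝ} {h : ℝ} (hh : 0 < h)
    (h0 : ∀ t, 0 ≤ p t)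
    (hp : Tendsto (fun t : ℝ≥0 => p t ^ (t : ℝ)) atTop (𝓝 h)) :
    Tendsto (fun t : ℝ≥0 => (t : ℝ) * (1 - p t)) atTop (𝓝 (-Real.log h)) := by
  have hpos : ∀ᶠ t : ℝ≥0 in atTop, 0 < p t := by
    filter_upwards [hp.eventually (lt_mem_nhds hh), eventually_gt_atTop 0] with t ht ht0
    refine lt_of_le_of_ne (h0 t) fun h => ?_
    rw [← h, Real.zero_rpow (by exact_mod_cast ht0.ne')] at ht
    exact lt_irrefl _ ht
  have hlog : Tendsto (fun t : ℝ≥0 => (t : ℝ) * Real.log (p t)) atTop (𝓝 (Real.log h)) := by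
    refine (((Real.continuousAt_log hh.ne').tendsto.comp hp)).congr' ?_
    filter_upwards [hpos] with t ht
    exact Real.log_rpow ht _
  have hcoe : Tendsto (fun t : ℝ≥0 => (t : ℝ)) atTop atTop := NNReal.tendsto_coe_atTop.2 tendsto_id
  have hlog0 : Tendsto (fun t : ℝ≥0 => Real.log (p t)) atTop (𝓝 0) := by
    have := hlog.mul (tendsto_inv_atTop_zero.comp hcoe)
    rw [mul_zero] at this
    refine this.congr' ?_
    filter_upwards [eventually_gt_atTop 0] with t ht
    have : (t : ℝ) ≠ 0 := by exact_mod_cast ht.ne'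
    simp only [Function.comp]
    field_simp
  have hp1 : Tendsto p atTop (𝓝 1) := by
    have := (Real.continuous_exp.tendsto 0).comp hlog0
    rw [Real.exp_zero] at this
    refine this.congr' ?_
    filter_upwards [hpos] with t ht using Real.exp_log ht
  have hlow := hlog.neg.mul hp1
  rw [mul_one] at hlow
  refine tendsto_of_tendsto_of_tendsto_of_le_of_le' hlow hlog.neg ?_ ?_
  · filter_upwards [hpos] with t ht
    have h1 := Real.one_sub_inv_le_log_of_pos ht
    have h2 : (1 - (p t)⁻¹) * p t ≤ Real.log (p t) * p t := mul_le_mul_of_nonneg_right h1 ht.le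
    rw [sub_mul, inv_mul_cancel₀ ht.ne', one_mul] at h2
    have := mul_le_mul_of_nonneg_left h2 t.coe_nonneg
    linarith
  · filter_upwards [hpos] with t ht
    have := mul_le_mul_of_nonneg_left (Real.log_le_sub_one_of_pos ht) t.coe_nonneg
    linarith

theorem tendsto_bivariateCDF_snd (μ : Measure (ℝ × ℝ)) [IsProbabilityMeasure μ] (x : ℝ) :
    Tendsto (fun n : ℕ => bivariateCDF μ (x, n)) atTop (𝓝 (μ.real (Prod.fst ⁻¹' Set.Iic x))) := by
  have h1 : Prod.fst ⁻¹' Set.Iic x = ⋃ n : ℕ, Set.Iic x ×ˢ Set.Iic (n : ℝ) := by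
    ext z
    simp only [Set.mem_preimage, Set.mem_iUnion, Set.mem_prod, Set.mem_Iic]
    exact ⟨fun h => (exists_nat_ge z.2).imp fun n hn => ⟨h, hn⟩, fun ⟨n, hn⟩ => hn.1⟩
  rw [h1]
  refine (ENNReal.tendsto_toReal (measure_ne_top _ _)).comp (tendsto_measure_iUnion_atTop ?_)
  exact fun m n hmn => Set.prod_mono_right (Set.Iic_subset_Iic.2 (Nat.cast_le.2 hmn))

theorem tendsto_bivariateCDF_fst (μ : Measure (ℝ × ℝ)) [IsProbabilityMeasure μ] (y : ℝ) :
    Tendsto (fun n : ℕ => bivariateCDF μ (n, y)) atTop (𝓝 (μ.real (Prod.snd ⁻¹' Set.Iic y))) := by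
  have h1 : Prod.snd ⁻¹' Set.Iic y = ⋃ n : ℕ, Set.Iic (n : ℝ) ×ˢ Set.Iic y := by
    ext z
    simp only [Set.mem_preimage, Set.mem_iUnion, Set.mem_prod, Set.mem_Iic]
    exact ⟨fun h => (exists_nat_ge z.1).imp fun n hn => ⟨hn, h⟩, fun ⟨n, hn⟩ => hn.2⟩
  rw [h1]
  refine (ENNReal.tendsto_toReal (measure_ne_top _ _)).comp (tendsto_measure_iUnion_atTop ?_)
  exact fun m n hmn => Set.prod_mono_left (Set.Iic_subset_Iic.2 (Nat.cast_le.2 hmn))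

theorem tendsto_gumbelProduct_snd (x : ℝ) :
    Tendsto (fun n : ℕ => gumbelProduct (x, n)) atTop (𝓝 (Real.exp (-Real.exp (-x)))) := by
  have h : Tendsto (fun n : ℕ => Real.exp (-(n : ℝ))) atTop (𝓝 0) :=
    Real.tendsto_exp_neg_atTop_nhds_zero.comp tendsto_natCast_atTop_atTop
  have := (Real.continuous_exp.tendsto _).comp (h.const_sub (-Real.exp (-x)))
  rwa [sub_zero] at this

theorem tendsto_gumbelProduct_fst (y : ℝ) :
    Tendsto (fun n : ℕ => gumbelProduct (n, y)) atTop (𝓝 (Real.exp (-Real.exp (-y)))) := by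
  refine (tendsto_gumbelProduct_snd y).congr fun n => ?_
  simp only [gumbelProduct]
  congr 1; ring

/-- Uniformity lets one coordinate go to infinity at fixed `t`, which yields the margins. The joint
tail follows by inclusion–exclusion: the two marginal limits and the limit of `t (1 - F)` cancel. -/
theorem HasGumbelTails.of_uniform {ν : ℝ≥0 → Measure (ℝ × ℝ)}
    (hpr : ∀ t, IsProbabilityMeasure (ν t))
    (hu : ∀ ε > 0, ∀ᶠ t : ℝ≥0 in atTop, ∀ z,
      |bivariateCDF (ν t) z ^ (t : ℝ) - gumbelProduct z| < ε) : HasGumbelTails ν := by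
  -- Covers the joint and both marginal cases at once: `g t` is a limit along `n` of values of the
  -- distribution function, and the uniform bound survives this limit as a weak inequality.
  have hlim : ∀ (g : ℝ≥0 → ℝ) (h : ℝ) (G : ℝ≥0 → ℕ → ℝ) (H : ℕ → ℝ),
      (∀ t n, ∃ z, G t n = bivariateCDF (ν t) z ∧ H n = gumbelProduct z) →
      (∀ t, Tendsto (G t) atTop (𝓝 (g t))) → Tendsto H atTop (𝓝 h) →
      Tendsto (fun t : ℝ≥0 => g t ^ (t : ℝ)) atTop (𝓝 h) := by
    intro g h G H hz hG hH
    rw [Metric.tendsto_nhds]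
    intro ε hε
    filter_upwards [hu (ε / 2) (half_pos hε)] with t ht
    have h1 : Tendsto (fun n => |G t n ^ (t : ℝ) - H n|) atTop (𝓝 |g t ^ (t : ℝ) - h|) :=
      (((Real.continuous_rpow_const t.coe_nonneg).tendsto _).comp (hG t)).sub hH |>.abs
    have h2 : |g t ^ (t : ℝ) - h| ≤ ε / 2 := le_of_tendsto' h1 fun n => by
      obtain ⟨z, e1, e2⟩ := hz t n
      rw [e1, e2]; exact (ht z).le
    rw [Real.dist_eq]
    linarith
  have hprod : ∀ x y, Tendsto (fun t : ℝ≥0 => (t : ℝ) * (1 - bivariateCDF (ν t) (x, y))) atTop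
      (𝓝 (Real.exp (-x) + Real.exp (-y))) := by
    intro x y
    have := tendsto_mul_one_sub_of_tendsto_rpow (Real.exp_pos _)
      (p := fun t => bivariateCDF (ν t) (x, y)) (fun t => measureReal_nonneg)
      (hlim _ (gumbelProduct (x, y)) (fun t _ => bivariateCDF (ν t) (x, y))
        (fun _ => gumbelProduct (x, y)) (fun t n => ⟨(x, y), rfl, rfl⟩)
        (fun t => tendsto_const_nhds) tendsto_const_nhds)
    rw [Real.log_exp] at this
    convert this using 2
    ring
  have hfst : ∀ x, Tendsto (fun t : ℝ≥0 => (t : ℝ) * (1 - (ν t).real (Prod.fst ⁻¹' Set.Iic x)))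
      atTop (𝓝 (Real.exp (-x))) := by
    intro x
    have := tendsto_mul_one_sub_of_tendsto_rpow (Real.exp_pos _)
      (p := fun t => (ν t).real (Prod.fst ⁻¹' Set.Iic x)) (fun t => measureReal_nonneg)
      (hlim _ _ (fun t n => bivariateCDF (ν t) (x, n)) (fun n => gumbelProduct (x, n))
        (fun t n => ⟨(x, n), rfl, rfl⟩) (fun t => tendsto_bivariateCDF_snd (ν t) x)
        (tendsto_gumbelProduct_snd x))
    rwa [Real.log_exp, neg_neg] at this
  have hsnd : ∀ y, Tendsto (fun t : ℝ≥0 => (t : ℝ) * (1 - (ν t).real (Prod.snd ⁻¹' Set.Iic y)))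
      atTop (𝓝 (Real.exp (-y))) := by
    intro y
    have := tendsto_mul_one_sub_of_tendsto_rpow (Real.exp_pos _)
      (p := fun t => (ν t).real (Prod.snd ⁻¹' Set.Iic y)) (fun t => measureReal_nonneg)
      (hlim _ _ (fun t n => bivariateCDF (ν t) (n, y)) (fun n => gumbelProduct (n, y))
        (fun t n => ⟨(n, y), rfl, rfl⟩) (fun t => tendsto_bivariateCDF_fst (ν t) y)
        (tendsto_gumbelProduct_fst y))
    rwa [Real.log_exp, neg_neg] at this
  have c1 : ∀ (t : ℝ≥0) (x : ℝ), (ν t).real (Prod.fst ⁻¹' Set.Ioi x)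
      = 1 - (ν t).real (Prod.fst ⁻¹' Set.Iic x) := fun t x => by
    rw [← probReal_compl_eq_one_sub (measurable_fst measurableSet_Iic), ← Set.preimage_compl,
      Set.compl_Iic]
  have c2 : ∀ (t : ℝ≥0) (x : ℝ), (ν t).real (Prod.snd ⁻¹' Set.Ioi x)
      = 1 - (ν t).real (Prod.snd ⁻¹' Set.Iic x) := fun t x => by
    rw [← probReal_compl_eq_one_sub (measurable_snd measurableSet_Iic), ← Set.preimage_compl,
      Set.compl_Iic]
  refine ⟨hpr, fun x => (hfst x).congr fun t => by rw [c1], fun y => (hsnd y).congr fun t => by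
    rw [c2], fun x y => ?_⟩
  have := ((hfst x).add (hsnd y)).sub (hprod x y)
  rw [sub_self] at this
  refine this.congr fun t => ?_
  have h1 := measureReal_union_add_inter (μ := ν t) (s := Prod.fst ⁻¹' Set.Ioi x)
    (t := Prod.snd ⁻¹' Set.Ioi y) (measurable_snd measurableSet_Ioi)
  have h2 : (Prod.fst ⁻¹' Set.Ioi x) ∪ (Prod.snd ⁻¹' Set.Ioi y)
      = (Set.Iic x ×ˢ Set.Iic y : Set (ℝ × ℝ))ᶜ := by
    ext z; simp only [Set.mem_union, Set.mem_preimage, Set.mem_Ioi, Set.mem_compl_iff, Set.mem_prod,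
      Set.mem_Iic, not_and_or, not_le]
  rw [h2, probReal_compl_eq_one_sub (measurableSet_Iic.prod measurableSet_Iic), c1, c2] at h1
  have h3 : (Prod.fst ⁻¹' Set.Ioi x) ∩ (Prod.snd ⁻¹' Set.Ioi y)
      = (Set.Ioi x ×ˢ Set.Ioi y : Set (ℝ × ℝ)) := rfl
  rw [h3] at h1
  unfold bivariateCDF
  simp only
  linear_combination -(t : ℝ) * h1

theorem IsInMDA.hasGumbelTails {ν : Measure (ℝ × ℝ)} [IsProbabilityMeasure ν]
    {a₁ b₁ a₂ b₂ : ℝ → ℝ} (h : IsInMDA (bivariateCDF ν) gumbelProduct a₁ b₁ a₂ b₂) :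
    HasGumbelTails fun t : ℝ≥0 =>
      ν.map fun z => ((z.1 - b₁ t) / a₁ t, (z.2 - b₂ t) / a₂ t) := by
  obtain ⟨h1, h2, h3⟩ := h
  have hcoe : Tendsto (fun t : ℝ≥0 => (t : ℝ)) atTop atTop := NNReal.tendsto_coe_atTop.2 tendsto_id
  have hm : ∀ t : ℝ≥0, Measurable fun z : ℝ × ℝ => ((z.1 - b₁ t) / a₁ t, (z.2 - b₂ t) / a₂ t) :=
    fun t => by fun_prop
  refine HasGumbelTails.of_uniform (fun t => Measure.isProbabilityMeasure_map
    (hm t).aemeasurable) fun ε hε => ?_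
  rw [Metric.tendstoUniformly_iff] at h3
  filter_upwards [hcoe.eventually h1, hcoe.eventually h2, hcoe.eventually (h3 ε hε)]
    with t ha₁ ha₂ ht z
  have e1 : bivariateCDF (ν.map fun z => ((z.1 - b₁ t) / a₁ t, (z.2 - b₂ t) / a₂ t)) z
      = bivariateCDF ν (a₁ t * z.1 + b₁ t, a₂ t * z.2 + b₂ t) := by
    unfold bivariateCDF
    rw [map_measureReal_apply (hm t) (measurableSet_Iic.prod measurableSet_Iic)]
    congr 1
    ext w
    simp only [Set.mem_preimage, Set.mem_prod, Set.mem_Iic, div_le_iff₀ ha₁, div_le_iff₀ ha₂,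
      sub_le_iff_le_add, mul_comm]
  rw [e1, ← Real.dist_eq, dist_comm]
  exact ht z

/-- Independent unit exponentials shifted by `log t` have asymptotically Gumbel tails. -/
theorem hasGumbelTails_exp : HasGumbelTails fun t : ℝ≥0 =>
    ((expMeasure 1).map (fun y => y - Real.log t)).prod
      ((expMeasure 1).map (fun y => y - Real.log t)) := by
  have hm : ∀ t : ℝ≥0, Measurable fun y => y - Real.log t := fun t => by fun_prop
  have hpr : ∀ t : ℝ≥0, IsProbabilityMeasure ((expMeasure 1).map (fun y => y - Real.log t)) :=
    fun t => Measure.isProbabilityMeasure_map (hm t).aemeasurable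
  have hcoe : Tendsto (fun t : ℝ≥0 => (t : ℝ)) atTop atTop := NNReal.tendsto_coe_atTop.2 tendsto_id
  -- As soon as `x + log t ≥ 0` the tail is exact: `t exp(-(x + log t)) = exp(-x)`.
  have key : ∀ x, ∀ᶠ t : ℝ≥0 in atTop,
      (t : ℝ) * ((expMeasure 1).map (fun y => y - Real.log t)).real (Set.Ioi x)
        = Real.exp (-x) := by
    intro x
    filter_upwards [(Real.tendsto_log_atTop.comp hcoe).eventually (eventually_ge_atTop (-x)),
      eventually_gt_atTop 0] with t ht ht0
    have ht0' : (0 : ℝ) < t := by exact_mod_cast ht0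
    rw [map_measureReal_apply (hm t) measurableSet_Ioi]
    have : (fun y => y - Real.log t) ⁻¹' Set.Ioi x = Set.Ioi (x + Real.log t) := by
      ext y; simp
    simp only [Function.comp] at ht
    rw [this, expMeasure_one_real_Ioi (by linarith), neg_add, Real.exp_add, Real.exp_neg (Real.log _),
      Real.exp_log ht0']
    field_simp
  refine ⟨fun t => inferInstance, fun x => ?_, fun x => ?_, fun x y => ?_⟩
  · refine tendsto_const_nhds.congr' ?_
    filter_upwards [key x] with t ht
    rw [← Set.prod_univ, measureReal_prod_prod]
    simp [ht]
  · refine tendsto_const_nhds.congr' ?_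
    filter_upwards [key x] with t ht
    rw [← Set.univ_prod, measureReal_prod_prod]
    simp [ht]
  · have : Tendsto (fun t : ℝ≥0 => Real.exp (-x) * Real.exp (-y) * (t : ℝ)⁻¹) atTop (𝓝 0) := by
      simpa using (tendsto_inv_atTop_zero.comp hcoe).const_mul (Real.exp (-x) * Real.exp (-y))
    refine this.congr' ?_
    filter_upwards [key x, key y, eventually_gt_atTop 0] with t hx hy ht0
    have : (t : ℝ) ≠ 0 := by exact_mod_cast ht0.ne'
    rw [measureReal_prod_prod, ← hx, ← hy]
    field_simp

/-! ### Powers with a random exponent -/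

namespace MeasureTheory.TendstoInDistribution

variable {ι E Ω' : Type*} {Ω : ι → Type*} {m : ∀ i, MeasurableSpace (Ω i)} [MeasurableSpace Ω']
  {μ : ∀ i, Measure (Ω i)} [∀ i, IsProbabilityMeasure (μ i)] {μ' : Measure Ω'}
  [IsProbabilityMeasure μ'] [TopologicalSpace E] [MeasurableSpace E] [OpensMeasurableSpace E]
  {X : (i : ι) → Ω i → E} {Z : Ω' → E} {l : Filter ι}

theorem tendsto_integral (h : TendstoInDistribution X l Z μ μ') {f : E → ℝ} (hf : Continuous f)
    {C : ℝ} (hC : ∀ x, |f x| ≤ C) :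
    Tendsto (fun i => ∫ ω, f (X i ω) ∂(μ i)) l (𝓝 (∫ ω, f (Z ω) ∂μ')) := by
  have h1 := ProbabilityMeasure.tendsto_iff_forall_integral_tendsto.1 h.tendsto
    (BoundedContinuousFunction.ofNormedAddCommGroup f hf C hC)
  simp only [BoundedContinuousFunction.coe_ofNormedAddCommGroup, ProbabilityMeasure.coe_mk] at h1
  rw [integral_map h.aemeasurable_limit hf.measurable.aestronglyMeasurable] at h1
  refine h1.congr fun i => ?_
  rw [integral_map (h.forall_aemeasurable i) hf.measurable.aestronglyMeasurable]

end MeasureTheory.TendstoInDistribution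

theorem tendsto_neg_mul_log {b : ℝ≥0 → ℝ} {L : ℝ}
    (hL : Tendsto (fun t : ℝ≥0 => (t : ℝ) * (1 - b t)) atTop (𝓝 L)) :
    (∀ᶠ t in atTop, 0 < b t) ∧
      Tendsto (fun t : ℝ≥0 => -((t : ℝ) * Real.log (b t))) atTop (𝓝 L) := by
  have hcoe : Tendsto (fun t : ℝ≥0 => (t : ℝ)) atTop atTop := NNReal.tendsto_coe_atTop.2 tendsto_id
  have hb1 : Tendsto b atTop (𝓝 1) := by
    have := ((hL.mul (tendsto_inv_atTop_zero.comp hcoe))).const_sub 1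
    rw [mul_zero, sub_zero] at this
    refine this.congr' ?_
    filter_upwards [eventually_gt_atTop 0] with t ht
    have : (t : ℝ) ≠ 0 := by exact_mod_cast ht.ne'
    simp only [Function.comp]
    field_simp
    ring
  have hpos : ∀ᶠ t in atTop, 0 < b t := hb1.eventually (lt_mem_nhds one_pos)
  refine ⟨hpos, ?_⟩
  have hup := hL.mul (hb1.inv₀ one_ne_zero)
  rw [inv_one, mul_one] at hup
  refine tendsto_of_tendsto_of_tendsto_of_le_of_le' hL hup ?_ ?_
  · filter_upwards [hpos] with t ht
    have := mul_le_mul_of_nonneg_left (Real.log_le_sub_one_of_pos ht) t.coe_nonneg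
    linarith
  · filter_upwards [hpos] with t ht
    have := mul_le_mul_of_nonneg_left (Real.one_sub_inv_le_log_of_pos ht) t.coe_nonneg
    have h2 : b t * (b t)⁻¹ = 1 := mul_inv_cancel₀ ht.ne'
    linear_combination this + (t : ℝ) * h2

section RandomIndex

variable {Ω Ω' : Type*} [MeasurableSpace Ω] [MeasurableSpace Ω'] {P : Measure Ω}
  [IsProbabilityMeasure P] {P' : Measure Ω'} [IsProbabilityMeasure P'] {N : ℝ≥0 → Ω → ℕ}
  {Z : Ω' → ℝ}

/-- The power equals `exp(-c N/t)` with `c = -t log b → L`, so Slutsky's theorem gives the limit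
`exp(-L Z)`. -/
theorem tendsto_integral_pow_random (hZ : ∀ᵐ ω ∂P', 0 < Z ω)
    (hNZ : TendstoInDistribution (fun (t : ℝ≥0) ω => (N t ω : ℝ) / (t : ℝ)) atTop Z
      (fun _ => P) P') {b : ℝ≥0 → ℝ} (hb : ∀ t, b t ≤ 1) {L : ℝ}
    (hL : Tendsto (fun t : ℝ≥0 => (t : ℝ) * (1 - b t)) atTop (𝓝 L)) :
    Tendsto (fun t : ℝ≥0 => ∫ ω, b t ^ N t ω ∂P) atTop
      (𝓝 (∫ ω, Real.exp (-(L * Z ω)) ∂P')) := by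
  obtain ⟨hpos, hc⟩ := tendsto_neg_mul_log hL
  have hL0 : 0 ≤ L := ge_of_tendsto' hL fun t =>
    mul_nonneg t.coe_nonneg (sub_nonneg.2 (hb t))
  have hmeas : TendstoInMeasure P (fun (t : ℝ≥0) (_ : Ω) => -((t : ℝ) * Real.log (b t))) atTop
      (fun _ => L) := by
    refine tendstoInMeasure_iff_dist.2 fun ε hε => tendsto_const_nhds.congr' ?_
    filter_upwards [hc.eventually (Metric.ball_mem_nhds L hε)] with t ht
    have : {x : Ω | ε ≤ dist (-((t : ℝ) * Real.log (b t))) L} = ∅ := by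
      ext x; simpa using ht
    rw [this, measure_empty]
  have hd := hNZ.continuous_comp_prodMk_of_tendstoInMeasure_const
    -- This cutoff and the one in `hi` make the test function bounded and continuous on the whole
    -- line. Neither acts where the exponent is nonpositive, as it is here, almost surely in the
    -- limit.
    (g := fun z : ℝ × ℝ => min 1 (Real.exp (-(z.2 * z.1)))) (by fun_prop) hmeas
    (fun t => aemeasurable_const)
  have hi := hd.tendsto_integral (f := fun y => max 0 (min 1 y)) (by fun_prop) (C := 1)
    (fun x => abs_le.2 ⟨by linarith [le_max_left 0 (min 1 x)], max_le zero_le_one (min_le_left _ _)⟩)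
  have hclamp : ∀ c z : ℝ, 0 ≤ c * z →
      max 0 (min 1 (min 1 (Real.exp (-(c * z))))) = Real.exp (-(c * z)) := by
    intro c z h
    have : Real.exp (-(c * z)) ≤ 1 := Real.exp_le_one_iff.2 (by linarith)
    rw [min_eq_right this, min_eq_right this, max_eq_right (Real.exp_nonneg _)]
  have e1 : ∫ ω, max 0 (min 1 (min 1 (Real.exp (-(L * Z ω))))) ∂P'
      = ∫ ω, Real.exp (-(L * Z ω)) ∂P' := by
    refine integral_congr_ae ?_
    filter_upwards [hZ] with ω hω using hclamp _ _ (mul_nonneg hL0 hω.le)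
  rw [← e1]
  refine hi.congr' ?_
  filter_upwards [hpos, eventually_gt_atTop 0] with t ht ht0
  have ht0' : (t : ℝ) ≠ 0 := by exact_mod_cast ht0.ne'
  congr 1 with ω
  rw [hclamp]
  · rw [← Real.exp_log ht, ← Real.exp_nat_mul, Real.log_exp]
    congr 1
    field_simp
  · refine mul_nonneg ?_ (by positivity)
    exact neg_nonneg.2 (mul_nonpos_of_nonneg_of_nonpos t.coe_nonneg
      (Real.log_nonpos ht.le (hb t)))

theorem tendsto_measureReal_random_lt (hZ : ∀ᵐ ω ∂P', 0 < Z ω)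
    (hNm : ∀ t, AEMeasurable (N t) P)
    (hNZ : TendstoInDistribution (fun (t : ℝ≥0) ω => (N t ω : ℝ) / (t : ℝ)) atTop Z
      (fun _ => P) P') (r : ℕ) :
    Tendsto (fun t : ℝ≥0 => P.real {ω | N t ω < r}) atTop (𝓝 0) := by
  -- `f k` is 1 up to `1/(k+1)` and 0 beyond `2/(k+1)`. It dominates the event `N t < r` once `t ≥
  -- (k + 1) r`, and its expectation at `Z` tends to 0 because `Z > 0`.
  let f : ℕ → ℝ → ℝ := fun k y => max 0 (min 1 (2 - (k + 1) * y))
  have hf0 : ∀ k y, 0 ≤ f k y := fun k y => le_max_left _ _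
  have hf1 : ∀ k y, f k y ≤ 1 := fun k y => max_le zero_le_one (min_le_left _ _)
  have hfb : ∀ k y, |f k y| ≤ 1 := fun k y => by rw [abs_of_nonneg (hf0 k y)]; exact hf1 k y
  have hfc : ∀ k, Continuous (f k) := fun k => by fun_prop
  have hlim : Tendsto (fun k => ∫ ω, f k (Z ω) ∂P') atTop (𝓝 0) := by
    have := tendsto_integral_of_dominated_convergence (μ := P') (F := fun k ω => f k (Z ω))
      (f := fun _ => 0) (fun _ => 1)
      (fun k => ((hfc k).measurable.comp_aemeasurable hNZ.aemeasurable_limit).aestronglyMeasurable)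
      (integrable_const _) (fun k => ae_of_all _ fun ω => hfb k _) (by
        filter_upwards [hZ] with ω hω
        refine tendsto_const_nhds.congr' ?_
        obtain ⟨K, hK⟩ := exists_nat_ge (2 / Z ω)
        filter_upwards [eventually_ge_atTop K] with k hk
        have : 2 ≤ (k + 1) * Z ω := by
          rw [div_le_iff₀ hω] at hK
          have : (K : ℝ) ≤ k + 1 := by exact_mod_cast hk.trans (Nat.le_succ k)
          exact hK.trans (mul_le_mul_of_nonneg_right this hω.le)
        exact (max_eq_left ((min_le_right _ _).trans (by linarith))).symm)
    simpa using this
  rw [Metric.tendsto_nhds]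
  intro ε hε
  obtain ⟨k, hk⟩ := (hlim.eventually (gt_mem_nhds hε)).exists
  have hcoe : Tendsto (fun t : ℝ≥0 => (t : ℝ)) atTop atTop := NNReal.tendsto_coe_atTop.2 tendsto_id
  filter_upwards [(hNZ.tendsto_integral (hfc k) (hfb k)).eventually (gt_mem_nhds hk),
    hcoe.eventually (eventually_ge_atTop ((k + 1 : ℝ) * r)), eventually_gt_atTop 0] with t ht htr ht0
  have ht0' : (0 : ℝ) < t := by exact_mod_cast ht0
  rw [Real.dist_eq, sub_zero, abs_of_nonneg measureReal_nonneg]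
  refine lt_of_le_of_lt ?_ ht
  have hms : NullMeasurableSet {ω | N t ω < r} P :=
    (hNm t).nullMeasurable measurableSet_Iio
  have : P.real {ω | N t ω < r} = ∫ ω, {ω | N t ω < r}.indicator (fun _ => (1 : ℝ)) ω ∂P := by
    rw [integral_indicator₀ hms]; simp
  rw [this]
  refine integral_mono ((integrable_const _).indicator₀ hms)
    (Integrable.of_bound ((hfc k).measurable.comp_aemeasurable
      (hNZ.forall_aemeasurable t)).aestronglyMeasurable 1 (ae_of_all _ fun ω => hfb k _)) fun ω => ?_
  by_cases hω : ω ∈ {ω | N t ω < r}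
  · rw [Set.indicator_of_mem hω]
    have h0 : N t ω < r := hω
    have h1 : (N t ω : ℝ) ≤ r := by exact_mod_cast h0.le
    have h2 : (k + 1 : ℝ) * (N t ω / t) ≤ 1 := by
      rw [← mul_div_assoc, div_le_one ht0']
      exact (mul_le_mul_of_nonneg_left h1 (by positivity)).trans htr
    exact le_max_of_le_right (le_min le_rfl (by linarith))
  · rw [Set.indicator_of_notMem hω]
    exact hf0 _ _

end RandomIndex

/-! ### Exceedance coordinates and Stone–Weierstrass -/

/-- A pair of real samples of common size: the size, and two sequences whose initial segments are
the samples. -/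
abbrev SamplePair : Type := ℕ × (Fin 2 → ℕ → ℝ)

namespace SamplePair

/-- The `r` largest values of both samples. -/
noncomputable def topStats (r : ℕ) (c : SamplePair) (i : Fin 2 × Fin r) : ℝ :=
  orderStat (c.2 i.1) c.1 (c.1 - i.2)

theorem measurable_topStats (r : ℕ) : Measurable (topStats r) := by
  refine measurable_from_prod_countable_right fun n => measurable_pi_lambda _ fun i => ?_
  exact (measurable_orderStat_sub n i.2).comp (measurable_pi_apply i.1)

/-- The product over both samples of the weights of their elements. -/
noncomputable def weight {m : ℕ} (x : Fin m → ℝ) (e : Fin 2 × Fin m → ℕ) (c : SamplePair) : ℝ :=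
  ∏ i ∈ Finset.range c.1, (levelWeight x (fun k => e (0, k)) (c.2 0 i) *
    levelWeight x (fun k => e (1, k)) (c.2 1 i))

/-- The numbers of exceedances of the levels `x` in both samples, on the scale `2 ^ (-·)`. -/
noncomputable def exceedCoord {m : ℕ} (x : Fin m → ℝ) (c : SamplePair) (k : Fin 2 × Fin m) :
    Set.Icc (0 : ℝ) 1 :=
  ⟨(1 / 2 : ℝ) ^ exceedCount (c.2 k.1) c.1 (x k.2), by positivity,
    pow_le_one₀ (by norm_num) (by norm_num)⟩

variable {m : ℕ} (x : Fin m → ℝ)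

theorem measurable_exceedCoord : Measurable (exceedCoord x) := by
  refine measurable_from_prod_countable_right fun n => measurable_pi_lambda _ fun k => ?_
  refine Measurable.subtype_mk ?_
  exact (measurable_from_top (f := fun j : ℕ => (1 / 2 : ℝ) ^ j)).comp
    ((measurable_exceedCount n (x k.2)).comp (measurable_pi_apply k.1))

/-- The scale `2 ^ (-·)` makes the coordinates range in a compact cube and makes their monomials
multiplicative over the sample. -/
theorem prod_exceedCoord_pow (e : Fin 2 × Fin m → ℕ) (c : SamplePair) :
    ∏ k, (exceedCoord x c k : ℝ) ^ e k = weight x e c := by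
  rw [Fintype.prod_prod_type, Fin.prod_univ_two, weight, Finset.prod_mul_distrib,
    ← prod_pow_half_exceedCount, ← prod_pow_half_exceedCount]
  rfl

theorem integrable_comp_exceedCoord (μ : Measure SamplePair) [IsProbabilityMeasure μ]
    (Ψ : C(Fin 2 × Fin m → Set.Icc (0 : ℝ) 1, ℝ)) :
    Integrable (fun c => Ψ (exceedCoord x c)) μ :=
  Integrable.of_bound (Ψ.continuous.measurable.comp (measurable_exceedCoord x)).aestronglyMeasurable
    ‖Ψ‖ (ae_of_all _ fun _ => Ψ.norm_coe_le_norm _)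

variable {ι : Type*} {l : Filter ι} {μ μ' : ι → Measure SamplePair}

/-- If the expected weights under two families of laws approach each other, then so do the
expectations of all continuous functions of the exceedance coordinates. -/
theorem tendsto_integral_comp_exceedCoord_sub (hμ : ∀ t, IsProbabilityMeasure (μ t))
    (hμ' : ∀ t, IsProbabilityMeasure (μ' t))
    (hw : ∀ e, Tendsto (fun t => ∫ c, weight x e c ∂(μ t) - ∫ c, weight x e c ∂(μ' t)) l (𝓝 0))
    (Ψ : C(Fin 2 × Fin m → Set.Icc (0 : ℝ) 1, ℝ)) :
    Tendsto (fun t => ∫ c, Ψ (exceedCoord x c) ∂(μ t) - ∫ c, Ψ (exceedCoord x c) ∂(μ' t)) l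
      (𝓝 0) := by
  let coord : Fin 2 × Fin m → C(Fin 2 × Fin m → Set.Icc (0 : ℝ) 1, ℝ) := fun k =>
    ⟨fun v => (v k : ℝ), by fun_prop⟩
  -- The functions with the desired property form a subspace. It contains the monomials by `hw`,
  -- hence the algebra generated by the coordinates, which is uniformly dense because coordinates
  -- separate points.
  let good : Submodule ℝ C(Fin 2 × Fin m → Set.Icc (0 : ℝ) 1, ℝ) :=
    { carrier := {Ψ | Tendsto (fun t => ∫ c, Ψ (exceedCoord x c) ∂(μ t) -
        ∫ c, Ψ (exceedCoord x c) ∂(μ' t)) l (𝓝 0)}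
      zero_mem' := by simpa using tendsto_const_nhds
      add_mem' := by
        intro f g hf hg
        have := Tendsto.add hf hg
        rw [add_zero] at this
        refine this.congr fun t => ?_
        simp only [ContinuousMap.add_apply]
        rw [integral_add (integrable_comp_exceedCoord x _ f) (integrable_comp_exceedCoord x _ g),
          integral_add (integrable_comp_exceedCoord x _ f) (integrable_comp_exceedCoord x _ g)]
        ring
      smul_mem' := by
        intro a f hf
        have := Tendsto.const_mul a hf
        rw [mul_zero] at this
        refine this.congr fun t => ?_
        simp only [ContinuousMap.smul_apply, smul_eq_mul, integral_const_mul]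
        ring }
  have hmono : ∀ f ∈ Submonoid.closure (Set.range coord),
      ∃ e : Fin 2 × Fin m → ℕ, ∀ v, f v = ∏ k, (v k : ℝ) ^ e k := by
    intro f hf
    induction hf using Submonoid.closure_induction with
    | mem f hf =>
      obtain ⟨k, rfl⟩ := hf
      refine ⟨Pi.single k 1, fun v => ?_⟩
      rw [Finset.prod_eq_single k]
      · simp [coord]
      · intro j _ hj; simp [Pi.single_eq_of_ne hj]
      · simp
    | one => exact ⟨0, fun v => by simp⟩
    | mul f g _ _ ihf ihg =>
      obtain ⟨e, he⟩ := ihf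
      obtain ⟨e', he'⟩ := ihg
      refine ⟨e + e', fun v => ?_⟩
      simp only [ContinuousMap.mul_apply, he, he', ← Finset.prod_mul_distrib, Pi.add_apply, pow_add]
  have hgood : ∀ f ∈ Algebra.adjoin ℝ (Set.range coord), f ∈ good := by
    intro f hf
    have h1 : f ∈ Submodule.span ℝ (Submonoid.closure (Set.range coord) :
        Set C(Fin 2 × Fin m → Set.Icc (0 : ℝ) 1, ℝ)) := by
      rw [← Algebra.adjoin_eq_span]; exact hf
    refine Submodule.span_le.2 (fun g hg => ?_) h1
    obtain ⟨e, he⟩ := hmono g hg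
    refine (hw e).congr fun t => ?_
    simp only [he, prod_exceedCoord_pow]
  have hsep : (Algebra.adjoin ℝ (Set.range coord)).SeparatesPoints := by
    intro v w hvw
    obtain ⟨k, hk⟩ := Function.ne_iff.1 hvw
    refine ⟨coord k, ⟨coord k, Algebra.subset_adjoin ⟨k, rfl⟩, rfl⟩, ?_⟩
    exact fun h => hk (Subtype.ext h)
  rw [Metric.tendsto_nhds]
  intro ε hε
  obtain ⟨⟨g, hg⟩, hgΨ⟩ := ContinuousMap.exists_mem_subalgebra_near_continuousMap_of_separatesPoints
    _ hsep Ψ (ε / 3) (by positivity)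
  simp only at hgΨ
  have hdiff : ∀ (ν : Measure SamplePair) [IsProbabilityMeasure ν],
      |∫ c, Ψ (exceedCoord x c) ∂ν - ∫ c, g (exceedCoord x c) ∂ν| ≤ ε / 3 := by
    intro ν _
    rw [← integral_sub (integrable_comp_exceedCoord x _ Ψ) (integrable_comp_exceedCoord x _ g),
      ← Real.norm_eq_abs]
    refine (norm_integral_le_of_norm_le_const (C := ε / 3) (ae_of_all _ fun c => ?_)).trans
      (by simp)
    rw [norm_sub_rev]
    exact ((g - Ψ).norm_coe_le_norm _).trans hgΨ.le
  filter_upwards [(Metric.tendsto_nhds.1 (hgood g hg)) (ε / 3) (by positivity)] with t ht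
  rw [Real.dist_eq, sub_zero] at ht ⊢
  have h1 := abs_le.1 (hdiff (μ t))
  have h2 := abs_le.1 (hdiff (μ' t))
  have h3 := abs_lt.1 ht
  exact abs_lt.2 ⟨by linarith, by linarith⟩

end SamplePair

/-! ### Recovering truncated largest values from counts -/

/-- The equidistant levels dividing `[-A, A]` into `m` parts. -/
noncomputable def gridLevel (A : ℝ) (m : ℕ) (k : Fin m) : ℝ := -A + k * (2 * A / m)

/-- The number of levels below `w` is `min m ⌈(w + A) / δ⌉` with mesh `δ = 2A/m`, so the expression
rounds the truncated `w` up to the grid. -/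
theorem abs_grid_sub_clamp_le {A : ℝ} (hA : 0 < A) {m : ℕ} (hm : 0 < m) (w : ℝ) :
    |(-A + 2 * A / m * ∑ k : Fin m, if gridLevel A m k < w then (1 : ℝ) else 0)
      - max (-A) (min A w)| ≤ 2 * A / m := by
  have hm' : (0 : ℝ) < m := by exact_mod_cast hm
  set δ := 2 * A / m with hδ
  have hδ0 : 0 < δ := by positivity
  have hmδ : m * δ = 2 * A := by rw [hδ]; field_simp
  set y := (w + A) / δ with hy
  have hyw : w = y * δ - A := by rw [hy]; field_simp; ring
  have hcount : (∑ k : Fin m, if gridLevel A m k < w then (1 : ℝ) else 0)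
      = (min m ⌈y⌉₊ : ℕ) := by
    rw [Finset.sum_boole]
    congr 1
    have h1 : ∀ k : Fin m, gridLevel A m k < w ↔ (k : ℕ) < ⌈y⌉₊ := by
      intro k
      rw [Nat.lt_ceil, hy, lt_div_iff₀ hδ0, gridLevel, ← hδ]
      constructor <;> intro h <;> linarith
    simp only [h1]
    rw [← Fin.card_filter_val_lt]
  rw [hcount]
  rcases le_or_gt y 0 with h0 | h0
  · have hw : w ≤ -A := by nlinarith
    rw [Nat.ceil_eq_zero.2 h0, Nat.min_zero, min_eq_right (show w ≤ A by linarith), max_eq_left hw]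
    simp [hδ0.le]
  · rcases le_or_gt y m with h1 | h1
    · have h2 : ⌈y⌉₊ ≤ m := Nat.ceil_le.2 h1
      have h3 : w ≤ A := by nlinarith
      have h4 : -A ≤ w := by nlinarith
      rw [min_eq_right h2, min_eq_right h3, max_eq_right h4]
      have h5 := Nat.le_ceil y
      have h6 := Nat.ceil_lt_add_one h0.le
      rw [abs_le]
      constructor <;> nlinarith
    · have h2 : m ≤ ⌈y⌉₊ := by exact_mod_cast h1.le.trans (Nat.le_ceil y)
      have h3 : A ≤ w := by nlinarith
      rw [min_eq_left h2, min_eq_left h3, max_eq_right (by linarith)]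
      rw [mul_comm, hmδ]
      simp only [two_mul, neg_add_cancel_left, sub_self, abs_zero]
      exact hδ0.le

/-- A continuous function on the line equal to the indicator of `n > j` at `2 ^ (-n)`. -/
noncomputable def halfPowIndicator (j : ℕ) (u : ℝ) : ℝ := max 0 (min 1 (2 - 2 ^ (j + 1) * u))

/-- The cutoff passes from 1 to 0 between `2^(-(j+1))` and `2^(-j)`, and no power `2^(-n)` lies
strictly between these. -/
theorem halfPowIndicator_half_pow (j n : ℕ) :
    halfPowIndicator j ((1 / 2 : ℝ) ^ n) = if j + 1 ≤ n then 1 else 0 := by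
  unfold halfPowIndicator
  split_ifs with h
  · have : (2 : ℝ) ^ (j + 1) * (1 / 2 : ℝ) ^ n ≤ 1 := by
      calc (2 : ℝ) ^ (j + 1) * (1 / 2 : ℝ) ^ n ≤ 2 ^ (j + 1) * (1 / 2 : ℝ) ^ (j + 1) := by
            refine mul_le_mul_of_nonneg_left ?_ (by positivity)
            exact pow_le_pow_of_le_one (by norm_num) (by norm_num) h
        _ = 1 := by rw [← mul_pow]; norm_num
    rw [min_eq_left (by linarith), max_eq_right zero_le_one]
  · have : 2 ≤ (2 : ℝ) ^ (j + 1) * (1 / 2 : ℝ) ^ n := by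
      calc (2 : ℝ) = 2 ^ (j + 1) * (1 / 2 : ℝ) ^ j := by
            rw [pow_succ, mul_right_comm, ← mul_pow]; norm_num
        _ ≤ _ := by
            refine mul_le_mul_of_nonneg_left ?_ (by positivity)
            exact pow_le_pow_of_le_one (by norm_num) (by norm_num) (by omega)
    exact max_eq_left ((min_le_right _ _).trans (by linarith))

/-- Coordinatewise truncation to `[-A, A]`. -/
noncomputable def clampVec {κ : Type*} (A : ℝ) (w : κ → ℝ) (i : κ) : ℝ := max (-A) (min A (w i))

theorem continuous_clampVec {κ : Type*} (A : ℝ) : Continuous (clampVec (κ := κ) A) := by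
  unfold clampVec; fun_prop

theorem norm_clampVec_le {κ : Type*} [Fintype κ] {A : ℝ} (hA : 0 ≤ A) (w : κ → ℝ) :
    ‖clampVec A w‖ ≤ ‖w‖ := by
  refine (pi_norm_le_iff_of_nonneg (norm_nonneg _)).2 fun i => le_trans ?_ (norm_le_pi_norm w i)
  rw [Real.norm_eq_abs, Real.norm_eq_abs, clampVec, abs_le]
  constructor
  · rcases le_total A (w i) with h | h
    · rw [min_eq_left h]; exact le_max_of_le_right (by linarith [abs_nonneg (w i)])
    · rw [min_eq_right h]; exact le_max_of_le_right (neg_abs_le _)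
  · refine max_le (by linarith [abs_nonneg (w i)]) ((min_le_right _ _).trans (le_abs_self _))

theorem le_norm_clampVec {κ : Type*} [Fintype κ] {A : ℝ} (hA : 0 ≤ A) {w : κ → ℝ}
    (h : clampVec A w ≠ w) : A ≤ ‖clampVec A w‖ := by
  obtain ⟨i, hi⟩ := Function.ne_iff.1 h
  refine le_trans ?_ (norm_le_pi_norm _ i)
  rw [Real.norm_eq_abs]
  rcases le_total A (w i) with h | h
  · rw [clampVec, min_eq_left h, max_eq_right (by linarith)]; exact le_abs_self A
  · rcases le_total (-A) (w i) with h' | h'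
    · exact absurd (by rw [clampVec, min_eq_right h, max_eq_right h']) hi
    · rw [clampVec, min_eq_right h, max_eq_left h', abs_neg]; exact le_abs_self A

namespace SamplePair

variable {r : ℕ} {h : (Fin 2 × Fin r → ℝ) → ℝ}

/-- Discretization of the truncated largest values through the exceedance coordinates. -/
noncomputable def gridVec (A : ℝ) (m : ℕ) (v : Fin 2 × Fin m → Set.Icc (0 : ℝ) 1)
    (i : Fin 2 × Fin r) : ℝ :=
  -A + 2 * A / m * ∑ k : Fin m, halfPowIndicator i.2 (v (i.1, k))

theorem continuous_gridVec (A : ℝ) (m : ℕ) : Continuous (gridVec (r := r) A m) := by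
  unfold gridVec halfPowIndicator; fun_prop

/-- By `lt_orderStat_iff` the cutoffs of the counts are the indicators of levels lying below the
order statistics. This needs `r ≤ c.1`, since missing order statistics are set to 0. -/
theorem dist_gridVec_le {A : ℝ} (hA : 0 < A) {m : ℕ} (hm : 0 < m) {c : SamplePair}
    (hc : r ≤ c.1) :
    dist (gridVec A m (exceedCoord (gridLevel A m) c)) (clampVec A (topStats r c))
      ≤ 2 * A / m := by
  refine (dist_pi_le_iff (by positivity)).2 fun i => ?_
  rw [Real.dist_eq]
  refine le_trans (le_of_eq ?_) (abs_grid_sub_clamp_le hA hm (topStats r c i))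
  simp only [gridVec, exceedCoord, halfPowIndicator_half_pow, clampVec, topStats,
    lt_orderStat_iff (c.2 i.1) (i.2.2.trans_le hc)]

variable {ι : Type*} {l : Filter ι} {μ μ' : ι → Measure SamplePair}

theorem integrable_comp_topStats (ν : Measure SamplePair) [IsProbabilityMeasure ν]
    (hc : Continuous h) {C : ℝ} (hC : ∀ w, |h w| ≤ C) :
    Integrable (fun c => h (topStats r c)) ν :=
  Integrable.of_bound (hc.measurable.comp (measurable_topStats r)).aestronglyMeasurable C
    (ae_of_all _ fun _ => hC _)

/-- The Lipschitz bound controls samples of size at least `r`; smaller samples cost at most `2 C`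
each. -/
theorem abs_integral_clampVec_sub_integral_gridVec_le (ν : Measure SamplePair)
    [IsProbabilityMeasure ν] {C : ℝ} (hC : ∀ w, |h w| ≤ C) {K : ℝ≥0} (hK : LipschitzWith K h)
    {A : ℝ} (hA : 0 < A) {m : ℕ} (hm : 0 < m) :
    |∫ c, h (clampVec A (topStats r c)) ∂ν
        - ∫ c, h (gridVec A m (exceedCoord (gridLevel A m) c)) ∂ν|
      ≤ K * (2 * A / m) + 2 * C * ν.real {c | c.1 < r} := by
  have hms : MeasurableSet {c : SamplePair | c.1 < r} := measurable_fst measurableSet_Iio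
  have hC0 : 0 ≤ C := (abs_nonneg _).trans (hC 0)
  have i1 : Integrable (fun c => h (clampVec A (topStats r c))) ν :=
    integrable_comp_topStats ν (hK.continuous.comp (continuous_clampVec A)) fun _ => hC _
  have i2 := integrable_comp_exceedCoord (gridLevel A m) ν
    ⟨fun v => h (gridVec A m v), hK.continuous.comp (continuous_gridVec A m)⟩
  simp only [ContinuousMap.coe_mk] at i2
  rw [← integral_sub i1 i2, ← Real.norm_eq_abs]
  have i3 : Integrable (fun c => K * (2 * A / m)
      + {c : SamplePair | c.1 < r}.indicator (fun _ => 2 * C) c) ν :=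
    (integrable_const _).add ((integrable_const _).indicator hms)
  refine (norm_integral_le_of_norm_le i3 (ae_of_all _ fun c => ?_)).trans (le_of_eq ?_)
  · rw [Real.norm_eq_abs]
    by_cases hc : c.1 < r
    · rw [Set.indicator_of_mem (by exact hc)]
      refine (abs_sub _ _).trans ?_
      have := hC (clampVec A (topStats r c))
      have := hC (gridVec A m (exceedCoord (gridLevel A m) c))
      have : 0 ≤ (K : ℝ) * (2 * A / m) := by positivity
      linarith
    · rw [Set.indicator_of_notMem (by exact hc), add_zero, ← Real.dist_eq]
      refine (hK.dist_le_mul _ _).trans (mul_le_mul_of_nonneg_left ?_ K.coe_nonneg)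
      rw [dist_comm]
      exact dist_gridVec_le hA hm (not_lt.1 hc)
  · rw [integral_add (integrable_const _) ((integrable_const _).indicator hms),
      integral_indicator hms]
    simp [mul_comm]

theorem tendsto_integral_clampVec_sub (hμ : ∀ t, IsProbabilityMeasure (μ t))
    (hμ' : ∀ t, IsProbabilityMeasure (μ' t))
    (hw : ∀ (m : ℕ) (x : Fin m → ℝ) (e : Fin 2 × Fin m → ℕ),
      Tendsto (fun t => ∫ c, weight x e c ∂(μ t) - ∫ c, weight x e c ∂(μ' t)) l (𝓝 0))
    (hn : Tendsto (fun t => (μ t).real {c | c.1 < r}) l (𝓝 0))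
    (hn' : Tendsto (fun t => (μ' t).real {c | c.1 < r}) l (𝓝 0))
    {C : ℝ} (hC : ∀ w, |h w| ≤ C) {K : ℝ≥0} (hK : LipschitzWith K h) {A : ℝ} (hA : 0 < A) :
    Tendsto (fun t => ∫ c, h (clampVec A (topStats r c)) ∂(μ t)
      - ∫ c, h (clampVec A (topStats r c)) ∂(μ' t)) l (𝓝 0) := by
  rw [Metric.tendsto_nhds]
  intro ε hε
  have hgrid : Tendsto (fun m : ℕ => (K : ℝ) * (2 * A / m)) atTop (𝓝 0) := by
    simpa using (tendsto_const_div_atTop_nhds_zero_nat (2 * A)).const_mul (K : ℝ)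
  obtain ⟨m, hmε, hm⟩ := ((hgrid.eventually (gt_mem_nhds (show 0 < ε / 4 by positivity))).and
    (eventually_gt_atTop 0)).exists
  have h1 := tendsto_integral_comp_exceedCoord_sub (gridLevel A m) hμ hμ' (hw m (gridLevel A m))
    ⟨fun v => h (gridVec A m v), hK.continuous.comp (continuous_gridVec A m)⟩
  simp only [ContinuousMap.coe_mk] at h1
  have h2 := hn.const_mul (2 * C)
  have h3 := hn'.const_mul (2 * C)
  rw [mul_zero] at h2 h3
  have hε8 : 0 < ε / 8 := by positivity
  filter_upwards [Metric.tendsto_nhds.1 h1 (ε / 4) (by positivity),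
    h2.eventually (gt_mem_nhds hε8), h3.eventually (gt_mem_nhds hε8)] with t g1 g2 g3
  rw [Real.dist_eq, sub_zero] at g1 ⊢
  have k1 := abs_le.1 (abs_integral_clampVec_sub_integral_gridVec_le (μ t) hC hK hA hm)
  have k2 := abs_le.1 (abs_integral_clampVec_sub_integral_gridVec_le (μ' t) hC hK hA hm)
  have k3 := abs_lt.1 g1
  exact abs_lt.2 ⟨by linarith, by linarith⟩

/-! ### Removing the truncation by tightness -/

/-- A Lipschitz function vanishing on the ball of radius `A` and equal to one off the ball of
radius `A + 1`. -/
noncomputable def tailBump {κ : Type*} [Fintype κ] (A : ℝ) (w : κ → ℝ) : ℝ :=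
  max 0 (min 1 (‖w‖ - A))

section TailBump

variable {κ : Type*} [Fintype κ] (A : ℝ)

theorem tailBump_nonneg (w : κ → ℝ) : 0 ≤ tailBump A w := le_max_left _ _

theorem tailBump_le_one (w : κ → ℝ) : tailBump A w ≤ 1 := max_le zero_le_one (min_le_left _ _)

theorem abs_tailBump_le_one (w : κ → ℝ) : |tailBump A w| ≤ 1 := by
  rw [abs_of_nonneg (tailBump_nonneg A w)]; exact tailBump_le_one A w

theorem lipschitzWith_tailBump : LipschitzWith 1 (tailBump (κ := κ) A) := by
  have h1 : LipschitzWith 1 fun w : κ → ℝ => ‖w‖ - A := by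
    refine LipschitzWith.of_dist_le_mul fun v w => ?_
    rw [NNReal.coe_one, one_mul, Real.dist_eq, sub_sub_sub_cancel_right, dist_eq_norm]
    exact abs_norm_sub_norm_le v w
  exact (h1.const_min 1).const_max 0

theorem tendsto_integral_tailBump (ρ : Measure (κ → ℝ)) [IsProbabilityMeasure ρ] :
    Tendsto (fun n : ℕ => ∫ w, tailBump (n : ℝ) w ∂ρ) atTop (𝓝 0) := by
  have := tendsto_integral_of_dominated_convergence (μ := ρ)
    (F := fun (n : ℕ) w => tailBump (n : ℝ) w) (f := fun _ => 0) (fun _ => 1)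
    (fun n => (lipschitzWith_tailBump _).continuous.measurable.aestronglyMeasurable)
    (integrable_const _) (fun n => ae_of_all _ fun w => abs_tailBump_le_one _ w)
    (ae_of_all _ fun w => by
      refine tendsto_const_nhds.congr' ?_
      obtain ⟨N, hN⟩ := exists_nat_ge ‖w‖
      filter_upwards [eventually_ge_atTop N] with n hn
      have : (N : ℝ) ≤ n := by exact_mod_cast hn
      exact (max_eq_left ((min_le_right _ _).trans (by linarith))).symm)
  simpa using this

/-- A vector moved by truncation at `A + 1` lands at norm at least `A + 1`, where the bump is 1.
Evaluating the bump at the truncated vector keeps the error bound within the truncated test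
functions. -/
theorem abs_sub_clampVec_le {h : (κ → ℝ) → ℝ} {C : ℝ} (hC : ∀ w, |h w| ≤ C) (hA : 0 ≤ A)
    (w : κ → ℝ) :
    |h w - h (clampVec (A + 1) w)| ≤ 2 * C * tailBump A (clampVec (A + 1) w) := by
  by_cases hw : clampVec (A + 1) w = w
  · have := (abs_nonneg _).trans (hC 0)
    rw [hw, sub_self, abs_zero]
    exact mul_nonneg (by linarith) (tailBump_nonneg _ _)
  · have h1 : tailBump A (clampVec (A + 1) w) = 1 := by
      have := le_norm_clampVec (by linarith) hw
      rw [tailBump, min_eq_left (by linarith), max_eq_right zero_le_one]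
    rw [h1, mul_one]
    refine (abs_sub _ _).trans ?_
    linarith [hC w, hC (clampVec (A + 1) w)]

theorem tailBump_clampVec_le (hA : 0 ≤ A) (w : κ → ℝ) :
    tailBump A (clampVec (A + 1) w) ≤ tailBump A w :=
  max_le_max le_rfl (min_le_min le_rfl (by linarith [norm_clampVec_le (show 0 ≤ A + 1 by linarith) w]))

end TailBump

/-- **Comparison of extremes**: if the expected weights under two families of laws of sample pairs
approach each other, and the sample sizes tend to infinity, then the largest values have the same
limit in distribution. -/
theorem tendsto_integral_topStats (hμ : ∀ t, IsProbabilityMeasure (μ t))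
    (hμ' : ∀ t, IsProbabilityMeasure (μ' t))
    (hw : ∀ (m : ℕ) (x : Fin m → ℝ) (e : Fin 2 × Fin m → ℕ),
      Tendsto (fun t => ∫ c, weight x e c ∂(μ t) - ∫ c, weight x e c ∂(μ' t)) l (𝓝 0))
    (hn : Tendsto (fun t => (μ t).real {c | c.1 < r}) l (𝓝 0))
    (hn' : Tendsto (fun t => (μ' t).real {c | c.1 < r}) l (𝓝 0))
    (ρ : Measure (Fin 2 × Fin r → ℝ)) [IsProbabilityMeasure ρ]
    (hlim : ∀ f : (Fin 2 × Fin r → ℝ) → ℝ, Continuous f → (∃ C, ∀ w, |f w| ≤ C) →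
      Tendsto (fun t => ∫ c, f (topStats r c) ∂(μ' t)) l (𝓝 (∫ w, f w ∂ρ)))
    {C : ℝ} (hC : ∀ w, |h w| ≤ C) {K : ℝ≥0} (hK : LipschitzWith K h) :
    Tendsto (fun t => ∫ c, h (topStats r c) ∂(μ t)) l (𝓝 (∫ w, h w ∂ρ)) := by
  have hC0 : 0 ≤ C := (abs_nonneg _).trans (hC 0)
  have hclamp : ∀ (g : (Fin 2 × Fin r → ℝ) → ℝ) (D : ℝ) (M : ℝ≥0), (∀ w, |g w| ≤ D) →
      LipschitzWith M g → ∀ A : ℝ, 0 < A →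
      Tendsto (fun t => ∫ c, g (clampVec A (topStats r c)) ∂(μ t)) l
        (𝓝 (∫ w, g (clampVec A w) ∂ρ)) := by
    intro g D M hD hM A hA
    have h1 := tendsto_integral_clampVec_sub hμ hμ' hw hn hn' hD hM hA
    have h2 := hlim (fun w => g (clampVec A w)) (hM.continuous.comp (continuous_clampVec A))
      ⟨D, fun w => hD _⟩
    have := h1.add h2
    rw [zero_add] at this
    exact this.congr fun t => by ring
  rw [Metric.tendsto_nhds]
  intro ε hε
  have htail := (tendsto_integral_tailBump ρ).const_mul (2 * C)
  rw [mul_zero] at htail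
  obtain ⟨n, hn4⟩ := (htail.eventually (gt_mem_nhds (show 0 < ε / 4 by positivity))).exists
  have hn0 : (0 : ℝ) ≤ n := n.cast_nonneg
  have hcont : ∀ A : ℝ, Continuous (clampVec (κ := Fin 2 × Fin r) A) := continuous_clampVec
  have hb : Continuous (tailBump (κ := Fin 2 × Fin r) n) := (lipschitzWith_tailBump _).continuous
  have hρ : |∫ w, h w ∂ρ - ∫ w, h (clampVec (n + 1) w) ∂ρ|
        ≤ 2 * C * ∫ w, tailBump n (clampVec (n + 1) w) ∂ρ := by
    have i1 : Integrable (fun w => h (clampVec (n + 1) w)) ρ := Integrable.of_bound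
      (hK.continuous.comp (hcont _)).measurable.aestronglyMeasurable C (ae_of_all _ fun _ => hC _)
    rw [← integral_sub (Integrable.of_bound hK.continuous.measurable.aestronglyMeasurable C
      (ae_of_all _ hC)) i1, ← integral_const_mul, ← Real.norm_eq_abs]
    refine norm_integral_le_of_norm_le ((Integrable.of_bound
      (hb.comp (hcont _)).measurable.aestronglyMeasurable 1
      (ae_of_all _ fun _ => abs_tailBump_le_one _ _)).const_mul _)
      (ae_of_all _ fun w => abs_sub_clampVec_le _ hC hn0 w)
  have hρ2 : ∫ w, tailBump n (clampVec (n + 1) w) ∂ρ ≤ ∫ w, tailBump (n : ℝ) w ∂ρ :=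
    integral_mono (Integrable.of_bound (hb.comp (hcont _)).measurable.aestronglyMeasurable 1
      (ae_of_all _ fun _ => abs_tailBump_le_one _ _))
      (Integrable.of_bound hb.measurable.aestronglyMeasurable 1
        (ae_of_all _ fun _ => abs_tailBump_le_one _ _)) fun w => tailBump_clampVec_le _ hn0 w
  have hμb : ∀ t, |∫ c, h (topStats r c) ∂(μ t) - ∫ c, h (clampVec (n + 1) (topStats r c)) ∂(μ t)|
      ≤ 2 * C * ∫ c, tailBump n (clampVec (n + 1) (topStats r c)) ∂(μ t) := by
    intro t
    rw [← integral_sub (integrable_comp_topStats _ hK.continuous hC)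
      (integrable_comp_topStats (h := fun w => h (clampVec (n + 1) w)) _
        (hK.continuous.comp (hcont _)) fun _ => hC _),
      ← integral_const_mul, ← Real.norm_eq_abs]
    exact norm_integral_le_of_norm_le ((integrable_comp_topStats _ (hb.comp (hcont _))
      fun _ => abs_tailBump_le_one _ _).const_mul _)
      (ae_of_all _ fun c => abs_sub_clampVec_le _ hC hn0 _)
  have g1 := hclamp h C K hC hK (n + 1) (by linarith)
  -- Tightness is known only for the limit `ρ`. Applying the truncated comparison to the bump itself
  -- transfers it to `μ t`.
  have g2 := (hclamp (tailBump n) 1 1 (abs_tailBump_le_one _) (lipschitzWith_tailBump _) (n + 1)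
    (by linarith)).const_mul (2 * C)
  have hsmall : 2 * C * ∫ w, tailBump n (clampVec (n + 1) w) ∂ρ < ε / 4 :=
    (mul_le_mul_of_nonneg_left hρ2 (by linarith)).trans_lt hn4
  filter_upwards [Metric.tendsto_nhds.1 g1 (ε / 4) (by positivity),
    g2.eventually (gt_mem_nhds hsmall)] with t k1 k2
  rw [Real.dist_eq] at k1 ⊢
  have k3 := abs_lt.1 k1
  have k4 := abs_le.1 (hμb t)
  have k5 := abs_le.1 hρ
  exact abs_lt.2 ⟨by linarith, by linarith⟩

end SamplePair

/-! ### Products over samples of random size -/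

/-- The expectation of a product over a sample of independent random size. -/
theorem integral_prod_range_random {Ω E : Type*} [MeasurableSpace Ω] [MeasurableSpace E]
    {P : Measure Ω} [IsProbabilityMeasure P] {V : ℕ → Ω → E} {ν : Measure E}
    (hV : ∀ n, HasLaw (V n) ν P) (hi : iIndepFun V P) {N : Ω → ℕ} (hN : AEMeasurable N P)
    (hNV : IndepFun N (fun ω n => V n ω) P) {g : E → ℝ} (hg : Measurable g)
    (hb : ∀ z, |g z| ≤ 1) :
    ∫ ω, ∏ i ∈ Finset.range (N ω), g (V i ω) ∂P = ∫ ω, (∫ z, g z ∂ν) ^ N ω ∂P := by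
  have hm : ∀ n, AEMeasurable (V n) P := fun n => (hV n).aemeasurable
  have hF : Measurable fun z : (ℕ → E) × ℕ => ∏ i ∈ Finset.range z.2, g (z.1 i) :=
    measurable_from_prod_countable_left fun n => by
      simp only
      exact Finset.measurable_fun_prod _ fun i _ => hg.comp (measurable_pi_apply i)
  have hFb : ∀ z : (ℕ → E) × ℕ, |∏ i ∈ Finset.range z.2, g (z.1 i)| ≤ 1 := fun z => by
    rw [Finset.abs_prod]
    exact Finset.prod_le_one (fun _ _ => abs_nonneg _) fun _ _ => hb _
  rw [integral_eq_integral_integral_of_indepFun (aemeasurable_pi_lambda _ hm) hN hNV.symm hF hFb]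
  congr 1 with ω'
  have h1 := ((hi.comp (fun _ => g) fun _ => hg).precomp
    (g := fun i : Fin (N ω') => (i : ℕ)) Fin.val_injective).integral_fun_prod_eq_prod_integral
    fun i => (hg.comp_aemeasurable (hm i)).aestronglyMeasurable
  simp only [Function.comp] at h1
  simp only [Finset.prod_range]
  rw [h1]
  have h2 : ∀ i : ℕ, ∫ ω, g (V i ω) ∂P = ∫ z, g z ∂ν := fun i => by
    rw [← (hV i).map_eq, integral_map (hm i) hg.aestronglyMeasurable]
  simp [h2]

section Reference

variable {Ω : Type*} [MeasurableSpace Ω] {P : Measure Ω}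
  {E : Fin 2 → ℕ → Ω → ℝ}

theorem indepFun_two_prefixes (hm : ∀ i j, AEMeasurable (E i j) P)
    (hi : iIndepFun (fun ij : Fin 2 × ℕ => E ij.1 ij.2) P) (n : ℕ) :
    IndepFun (fun ω l => if l < n then E 0 l ω else 0) (fun ω l => if l < n then E 1 l ω else 0)
      P := by
  have h := hi.indepFun_finset₀ (({0} : Finset (Fin 2)) ×ˢ Finset.range n)
    (({1} : Finset (Fin 2)) ×ˢ Finset.range n) (by
      rw [Finset.disjoint_left]
      rintro ⟨i, j⟩ h0 h1
      simp only [Finset.mem_product, Finset.mem_singleton] at h0 h1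
      exact absurd (h0.1.symm.trans h1.1) (by decide)) fun ij => hm ij.1 ij.2
  have hφ : ∀ c : Fin 2, Measurable fun
      (a : (({c} : Finset (Fin 2)) ×ˢ Finset.range n : Finset (Fin 2 × ℕ)) → ℝ) (l : ℕ) =>
      if h : l < n then a ⟨(c, l), by simpa using h⟩ else 0 := fun c =>
    measurable_pi_lambda _ fun l => by
      by_cases h : l < n
      · simp only [h, dite_true]; exact measurable_pi_apply _
      · simp only [h, dite_false]; exact measurable_const
  exact h.comp (hφ 0) (hφ 1)

variable [IsProbabilityMeasure P]

/-- The two exponential families are independent, so the expectation factorises and Rényi's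
representation applies to each. How the points of the two samples are paired is immaterial, because
the product runs over all of them. -/
theorem integral_prod_two_renyi (hE : ∀ i j, HasLaw (E i j) (expMeasure 1) P)
    (hi : iIndepFun (fun ij : Fin 2 × ℕ => E ij.1 ij.2) P) {f : Fin 2 → ℝ → ℝ}
    (hf : ∀ c, Measurable (f c)) (hb : ∀ c x, |f c x| ≤ 1)
    (hc : ∀ c, {x | ¬ ContinuousAt (f c) x}.Countable) (n : ℕ) (x : ℝ) :
    ∫ ω, ∏ j ∈ Finset.range n, (f 0 (x + ∑ l ∈ Finset.Ico j n, E 0 l ω / (l + 1)) *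
        f 1 (x + ∑ l ∈ Finset.Ico j n, E 1 l ω / (l + 1))) ∂P
      = ((∫ y, f 0 (x + y) ∂(expMeasure 1)) * ∫ y, f 1 (x + y) ∂(expMeasure 1)) ^ n := by
  have hm : ∀ i j, AEMeasurable (E i j) P := fun i j => (hE i j).aemeasurable
  have hF : ∀ c, Measurable fun e : ℕ → ℝ =>
      ∏ j ∈ Finset.range n, f c (x + ∑ l ∈ Finset.Ico j n, e l / (l + 1)) := fun c => by
    have := hf c
    fun_prop
  have hpre : ∀ c, AEMeasurable (fun ω (l : ℕ) => if l < n then E c l ω else 0) P := fun c =>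
    aemeasurable_pi_lambda _ fun l => by
      by_cases h : l < n
      · simpa only [h, if_true] using hm c l
      · simp only [h, if_false]; fun_prop
  have e1 : ∀ c ω, ∏ j ∈ Finset.range n, f c (x + ∑ l ∈ Finset.Ico j n,
      (if l < n then E c l ω else 0) / (l + 1))
        = ∏ j ∈ Finset.range n, f c (x + ∑ l ∈ Finset.Ico j n, E c l ω / (l + 1)) := by
    intro c ω
    refine Finset.prod_congr rfl fun j _ => ?_
    congr 2
    refine Finset.sum_congr rfl fun l hl => ?_
    rw [if_pos (Finset.mem_Ico.1 hl).2]
  have h1 := ((indepFun_two_prefixes hm hi n).comp (hF 0) (hF 1)).integral_fun_mul_eq_mul_integral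
    ((hF 0).comp_aemeasurable (hpre 0)).aestronglyMeasurable
    ((hF 1).comp_aemeasurable (hpre 1)).aestronglyMeasurable
  simp only [Function.comp, e1] at h1
  simp_rw [Finset.prod_mul_distrib]
  have hic : ∀ c, iIndepFun (E c) P := fun c =>
    hi.precomp (g := fun j : ℕ => (c, j)) fun _ _ h => (Prod.ext_iff.1 h).2
  rw [h1, integral_prod_renyi (hE 0) (hic 0) (hf 0) (hb 0) (hc 0),
    integral_prod_renyi (hE 1) (hic 1) (hf 1) (hb 1) (hc 1), mul_pow]

theorem integral_prod_two_renyi_random (hE : ∀ i j, HasLaw (E i j) (expMeasure 1) P)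
    (hi : iIndepFun (fun ij : Fin 2 × ℕ => E ij.1 ij.2) P) {N : Ω → ℕ} (hN : AEMeasurable N P)
    (hNE : IndepFun N (fun ω (ij : Fin 2 × ℕ) => E ij.1 ij.2 ω) P) {f : Fin 2 → ℝ → ℝ}
    (hf : ∀ c, Measurable (f c)) (hb : ∀ c x, |f c x| ≤ 1)
    (hc : ∀ c, {x | ¬ ContinuousAt (f c) x}.Countable) (x : ℝ) :
    ∫ ω, ∏ j ∈ Finset.range (N ω), (f 0 (x + ∑ l ∈ Finset.Ico j (N ω), E 0 l ω / (l + 1)) *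
        f 1 (x + ∑ l ∈ Finset.Ico j (N ω), E 1 l ω / (l + 1))) ∂P
      = ∫ ω, ((∫ y, f 0 (x + y) ∂(expMeasure 1)) * ∫ y, f 1 (x + y) ∂(expMeasure 1)) ^ N ω ∂P := by
  have hm : ∀ i j, AEMeasurable (E i j) P := fun i j => (hE i j).aemeasurable
  let F : (Fin 2 × ℕ → ℝ) × ℕ → ℝ := fun z => ∏ j ∈ Finset.range z.2,
    (f 0 (x + ∑ l ∈ Finset.Ico j z.2, z.1 (0, l) / (l + 1)) *
      f 1 (x + ∑ l ∈ Finset.Ico j z.2, z.1 (1, l) / (l + 1)))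
  have hF : Measurable F := measurable_from_prod_countable_left fun n => by
    have := hf 0
    have := hf 1
    simp only [F]
    fun_prop
  have hFb : ∀ z, |F z| ≤ 1 := fun z => by
    simp only [F]
    rw [Finset.abs_prod]
    refine Finset.prod_le_one (fun _ _ => abs_nonneg _) fun _ _ => ?_
    rw [abs_mul]
    exact mul_le_one₀ (hb _ _) (abs_nonneg _) (hb _ _)
  have key := integral_eq_integral_integral_of_indepFun
    (aemeasurable_pi_lambda (fun ω (ij : Fin 2 × ℕ) => E ij.1 ij.2 ω) fun ij => hm ij.1 ij.2)
    hN hNE.symm hF hFb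
  simp only [F] at key
  rw [key]
  congr 1 with ω'
  exact integral_prod_two_renyi hE hi hf hb hc _ x

end Reference

/-! ### Almost sure convergence of centred independent series -/

section Kolmogorov

variable {Ω : Type*} [MeasurableSpace Ω] {P : Measure Ω} [IsProbabilityMeasure P]
  {X : ℕ → Ω → ℝ}

theorem iIndepFun.integral_sq_sum_range (hX : ∀ i, MemLp (X i) 2 P) (hi : iIndepFun X P)
    (h0 : ∀ i, ∫ ω, X i ω ∂P = 0) (n : ℕ) :
    ∫ ω, (∑ i ∈ Finset.range n, X i ω) ^ 2 ∂P = ∑ i ∈ Finset.range n, ∫ ω, X i ω ^ 2 ∂P := by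
  have h1 := IndepFun.variance_sum (s := Finset.range n) (fun i _ => hX i)
    (fun i _ j _ hij => hi.indepFun hij)
  have hS : MemLp (∑ i ∈ Finset.range n, X i) 2 P := memLp_finsetSum' _ fun i _ => hX i
  have hS0 : ∫ ω, (∑ i ∈ Finset.range n, X i) ω ∂P = 0 := by
    simp only [Finset.sum_apply]
    rw [integral_finsetSum _ fun i _ => (hX i).integrable (by norm_num)]
    simp [h0]
  rw [variance_of_integral_eq_zero hS.aestronglyMeasurable.aemeasurable hS0] at h1
  simp only [Finset.sum_apply] at h1
  rw [h1]
  exact Finset.sum_congr rfl fun i _ =>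
    variance_of_integral_eq_zero (hX i).aestronglyMeasurable.aemeasurable (h0 i)

/-- The partial sums form a martingale, bounded in `L¹` because `|s| ≤ 1 + s²` and the variances are
summable. Martingale convergence applies. -/
theorem iIndepFun.ae_exists_tendsto_sum_of_measurable (hm : ∀ i, Measurable (X i))
    (hX : ∀ i, MemLp (X i) 2 P) (hi : iIndepFun X P) (h0 : ∀ i, ∫ ω, X i ω ∂P = 0)
    (hs : Summable fun i => ∫ ω, X i ω ^ 2 ∂P) :
    ∀ᵐ ω ∂P, ∃ c, Tendsto (fun n => ∑ i ∈ Finset.range n, X i ω) atTop (𝓝 c) := by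
  have hsm : ∀ i, StronglyMeasurable (X i) := fun i => (hm i).stronglyMeasurable
  -- With `n + 1` terms, `S n` is adapted to the natural filtration at `n`, and its next increment
  -- `X (n + 1)` is independent of that filtration.
  let S : ℕ → Ω → ℝ := fun n => ∑ i ∈ Finset.range (n + 1), X i
  have hint : ∀ i, Integrable (X i) P := fun i => (hX i).integrable (by norm_num)
  have hSint : ∀ n, Integrable (S n) P := fun n => integrable_finsetSum' _ fun i _ => hint i
  have hmart : Martingale S (Filtration.natural X hsm) P := by
    refine martingale_of_condExp_sub_eq_zero_nat (fun n => ?_) hSint fun n => ?_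
    · refine Finset.stronglyMeasurable_sum _ fun i hi => ?_
      exact ((Filtration.stronglyAdapted_natural hsm) i).mono
        ((Filtration.natural X hsm).mono (Finset.mem_range_succ_iff.1 hi))
    · have : S (n + 1) - S n = X (n + 1) := by
        simp only [S, Finset.sum_range_succ _ (n + 1), add_sub_cancel_left]
      rw [this]
      refine (iIndepFun.condExp_natural_ae_eq_of_lt hsm hi (Nat.lt_succ_self n)).trans ?_
      rw [h0]; rfl
  have hbdd : ∀ n, eLpNorm (S n) 1 P ≤
      ((1 + ∑' i, ∫ ω, X i ω ^ 2 ∂P).toNNReal : ℝ≥0) := by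
    intro n
    have hS2 : Integrable (fun ω => S n ω ^ 2) P :=
      (memLp_finsetSum' _ fun i _ => hX i : MemLp (S n) 2 P).integrable_sq
    rw [eLpNorm_one_eq_lintegral_enorm, ← ofReal_integral_norm_eq_lintegral_enorm (hSint n)]
    refine ENNReal.ofReal_le_ofReal ?_
    calc ∫ ω, ‖S n ω‖ ∂P ≤ ∫ ω, (1 + S n ω ^ 2) ∂P := by
          refine integral_mono (hSint n).norm ((integrable_const _).add hS2) fun ω => ?_
          simp only [Real.norm_eq_abs]
          nlinarith [abs_nonneg (S n ω), sq_abs (S n ω), sq_nonneg (|S n ω| - 1)]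
      _ = 1 + ∑ i ∈ Finset.range (n + 1), ∫ ω, X i ω ^ 2 ∂P := by
          rw [integral_add (integrable_const _) hS2,
            ← iIndepFun.integral_sq_sum_range hX hi h0]
          simp [S]
      _ ≤ _ := by
          gcongr
          exact hs.sum_le_tsum _ fun i _ => integral_nonneg fun ω => sq_nonneg _
  filter_upwards [hmart.submartingale.exists_ae_tendsto_of_bdd hbdd] with ω ⟨c, hc⟩
  refine ⟨c, (tendsto_add_atTop_iff_nat 1).1 ?_⟩
  simpa [S] using hc

/-- **Kolmogorov's two-series theorem** for centred random variables: a series of independent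
centred random variables with summable variances converges almost surely. -/
theorem iIndepFun.ae_exists_tendsto_sum (hX : ∀ i, MemLp (X i) 2 P) (hi : iIndepFun X P)
    (h0 : ∀ i, ∫ ω, X i ω ∂P = 0) (hs : Summable fun i => ∫ ω, X i ω ^ 2 ∂P) :
    ∀ᵐ ω ∂P, ∃ c, Tendsto (fun n => ∑ i ∈ Finset.range n, X i ω) atTop (𝓝 c) := by
  have hm : ∀ i, AEMeasurable (X i) P := fun i => (hX i).aestronglyMeasurable.aemeasurable
  have hae : ∀ i, X i =ᵐ[P] (hm i).mk (X i) := fun i => (hm i).ae_eq_mk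
  have h := iIndepFun.ae_exists_tendsto_sum_of_measurable (fun i => (hm i).measurable_mk)
    (fun i => (hX i).ae_eq (hae i)) (hi.congr hae)
    (fun i => by rw [← h0 i]; exact integral_congr_ae (hae i).symm)
    (hs.congr fun i => integral_congr_ae ((hae i).mono fun ω h => by simp only [h]))
  filter_upwards [h, ae_all_iff.2 hae] with ω ⟨c, hc⟩ hω
  exact ⟨c, by simpa only [hω] using hc⟩

/-- The terms are centred since the unit exponential has mean 1, and their variances are a constant
times `1 / (j + 1)²`. -/
theorem ae_exists_tendsto_tailPartialSum {e : ℕ → Ω → ℝ}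
    (he : ∀ i, HasLaw (e i) (expMeasure 1) P) (hi : iIndepFun e P) :
    ∀ᵐ ω ∂P, ∃ c, Tendsto (tailPartialSum (fun j => e j ω) 0) atTop (𝓝 c) := by
  let φ : ℕ → ℝ → ℝ := fun j y => (y - 1) / ((j : ℝ) + 1)
  have hφ : ∀ j, Measurable (φ j) := fun j => by fun_prop
  have hid : Integrable (fun y : ℝ => y) (expMeasure 1) := by
    simpa using integrable_pow_expMeasure_one 1
  have hid2 : MemLp (fun y : ℝ => y) 2 (expMeasure 1) :=
    (memLp_two_iff_integrable_sq measurable_id.aestronglyMeasurable).2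
      (integrable_pow_expMeasure_one 2)
  have hφ2 : ∀ j, MemLp (φ j) 2 (expMeasure 1) := fun j => by
    have := (hid2.sub (memLp_const (1 : ℝ))).const_mul ((j : ℝ) + 1)⁻¹
    refine this.congr_norm (hφ j).aestronglyMeasurable (ae_of_all _ fun y => ?_)
    simp [φ, div_eq_inv_mul]
  have hsq : ∀ j, ∫ ω, φ j (e j ω) ^ 2 ∂P
      = (∫ y, (y - 1) ^ 2 ∂(expMeasure 1)) * (1 / ((j : ℝ) + 1) ^ 2) := fun j => by
    rw [← integral_map (he j).aemeasurable ((hφ j).pow_const 2).aestronglyMeasurable,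
      (he j).map_eq, ← integral_mul_const]
    congr 1 with y
    simp only [φ]
    rw [div_pow, div_eq_mul_one_div]
  have h := iIndepFun.ae_exists_tendsto_sum (X := fun j ω => φ j (e j ω)) (P := P)
    (fun j => by
      have := hφ2 j
      rw [← (he j).map_eq] at this
      exact this.comp_of_map (he j).aemeasurable)
    (hi.comp φ hφ)
    (fun j => by
      rw [← integral_map (he j).aemeasurable (hφ j).aestronglyMeasurable, (he j).map_eq]
      simp only [φ]
      rw [integral_div, integral_sub hid (integrable_const _), integral_id_expMeasure_one]
      simp)
    (by
      simp_rw [hsq]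
      refine Summable.mul_left _ ?_
      have := (summable_nat_add_iff 1).2 (Real.summable_one_div_nat_pow.2 one_lt_two)
      simpa using this)
  filter_upwards [h] with ω ⟨c, hc⟩
  refine ⟨c, ?_⟩
  unfold tailPartialSum
  simpa only [← Finset.range_eq_Ico] using hc

end Kolmogorov

/-! ### The limit variables -/

section TailSum

variable {e : ℕ → ℝ}

theorem tailPartialSum_eq_add {p q n : ℕ} (hpq : p ≤ q) (hqn : q ≤ n) :
    tailPartialSum e p n = tailPartialSum e p q + tailPartialSum e q n :=
  (Finset.sum_Ico_consecutive _ hpq hqn).symm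

theorem tendsto_tailPartialSum (h : ∃ c, Tendsto (tailPartialSum e 0) atTop (𝓝 c)) (p : ℕ) :
    Tendsto (tailPartialSum e p) atTop (𝓝 (tailSum e p)) := by
  obtain ⟨c, hc⟩ := h
  refine tendsto_nhds_limUnder ⟨c - tailPartialSum e 0 p, (hc.sub_const _).congr' ?_⟩
  filter_upwards [eventually_ge_atTop p] with n hn
  rw [tailPartialSum_eq_add (Nat.zero_le p) hn, add_sub_cancel_left]

theorem tailSum_eq_add (h : ∃ c, Tendsto (tailPartialSum e 0) atTop (𝓝 c)) {p q : ℕ}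
    (hpq : p ≤ q) : tailSum e p = tailPartialSum e p q + tailSum e q := by
  refine tendsto_nhds_unique (tendsto_tailPartialSum h p)
    (((tendsto_tailPartialSum h q).const_add _).congr' ?_)
  filter_upwards [eventually_ge_atTop q] with n hn
  rw [tailPartialSum_eq_add hpq hn]

theorem harmonic_eq_add_sum_Ico {j n : ℕ} (hjn : j ≤ n) :
    (harmonic n : ℝ) = harmonic j + ∑ l ∈ Finset.Ico j n, 1 / ((l : ℝ) + 1) := by
  have : ∀ n, (harmonic n : ℝ) = ∑ l ∈ Finset.range n, 1 / ((l : ℝ) + 1) := fun n => by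
    simp [harmonic]
  rw [this, this, Finset.sum_range_add_sum_Ico _ hjn]

theorem sum_Ico_div_eq {j n : ℕ} (hjn : j ≤ n) :
    ∑ l ∈ Finset.Ico j n, e l / ((l : ℝ) + 1)
      = tailPartialSum e j n + (harmonic n - harmonic j) := by
  rw [harmonic_eq_add_sum_Ico hjn, add_sub_cancel_left, tailPartialSum, ← Finset.sum_add_distrib]
  refine Finset.sum_congr rfl fun l _ => ?_
  ring

/-- The limit of the `j`-th largest value is the common term at `p` plus `∑_{j ≤ l < p} e_l / (l +
1)`, the harmonic numbers cancelling. Interchanging the sums gives `e_l` the coefficient `(k_0 + ⋯ +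
k_l) / (l + 1)`, a running mean. -/
theorem treatyLimit_eq_sum (h : ∃ c, Tendsto (tailPartialSum e 0) atTop (𝓝 c)) (k : ℕ → ℝ)
    (p : ℕ) (z : ℝ) :
    treatyLimit k p e z
      = ∑ j ∈ Finset.range p, k j * (tailSum e j + Real.log z + eulerMinusHarmonic j) := by
  have h1 : ∀ j ∈ Finset.range p, k j * (tailSum e j + Real.log z + eulerMinusHarmonic j)
      = (∑ l ∈ Finset.Ico j p, k j * (e l / ((l : ℝ) + 1)))
        + k j * (tailSum e p + Real.log z + eulerMinusHarmonic p) := by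
    intro j hj
    have hjp := (Finset.mem_range.1 hj).le
    rw [← Finset.mul_sum, sum_Ico_div_eq hjp, tailSum_eq_add h hjp]
    simp only [eulerMinusHarmonic]
    ring
  rw [Finset.sum_congr rfl h1, Finset.sum_add_distrib, ← Finset.sum_mul, treatyLimit, coeffSum]
  congr 1
  rw [Finset.range_eq_Ico, Finset.sum_Ico_Ico_comm]
  refine Finset.sum_congr rfl fun l _ => ?_
  rw [← Finset.sum_mul, runningMean, coeffSum, Finset.range_eq_Ico]
  push_cast
  ring

/-- The partial sums of `e l / (l + 1)` up to `z t`, centred by `log t`, converge. -/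
theorem tendsto_sum_Ico_sub_log (h : ∃ c, Tendsto (tailPartialSum e 0) atTop (𝓝 c)) {z : ℝ}
    (hz : 0 < z) (j : ℕ) :
    Tendsto (fun t : ℝ≥0 => -Real.log t + ∑ l ∈ Finset.Ico j ⌊z * t⌋₊, e l / ((l : ℝ) + 1)) atTop
      (𝓝 (tailSum e j + Real.log z + eulerMinusHarmonic j)) := by
  have hcoe : Tendsto (fun t : ℝ≥0 => (t : ℝ)) atTop atTop := NNReal.tendsto_coe_atTop.2 tendsto_id
  have hn : Tendsto (fun t : ℝ≥0 => ⌊z * t⌋₊) atTop atTop :=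
    tendsto_nat_floor_atTop.comp (hcoe.const_mul_atTop hz)
  have h1 := (tendsto_tailPartialSum h j).comp hn
  have h2 := Real.tendsto_harmonic_sub_log.comp hn
  have h3 := (Real.continuousAt_log hz.ne').tendsto.comp
    ((tendsto_nat_floor_mul_div_atTop hz.le).comp hcoe)
  -- With `n = ⌊z t⌋` the sum splits into the centred partial sum, `log (n / t) → log z`, and `H_n -
  -- log n - H_j`, which tends to `K_j`.
  have := (h1.add h3).add (h2.sub_const (harmonic j : ℝ))
  refine this.congr' ?_
  filter_upwards [hn.eventually (eventually_ge_atTop (j + 1)), eventually_gt_atTop 0] with t ht ht0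
  have ht0' : (t : ℝ) ≠ 0 := by exact_mod_cast ht0.ne'
  have hn0 : (⌊z * t⌋₊ : ℝ) ≠ 0 := by
    have : ⌊z * t⌋₊ ≠ 0 := by omega
    exact_mod_cast this
  simp only [Function.comp]
  rw [sum_Ico_div_eq (by omega), Real.log_div hn0 ht0']
  ring

end TailSum

/-! ### The reference sample -/

theorem SamplePair.measurable_weight {m : ℕ} (x : Fin m → ℝ) (e : Fin 2 × Fin m → ℕ) :
    Measurable (SamplePair.weight x e) := by
  have : SamplePair.weight x e = fun c => ∏ k, (SamplePair.exceedCoord x c k : ℝ) ^ e k := by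
    ext c; rw [SamplePair.prod_exceedCoord_pow]
  rw [this]
  exact Finset.measurable_fun_prod _ fun k _ => (measurable_subtype_coe.comp
    ((measurable_pi_apply k).comp (SamplePair.measurable_exceedCoord x))).pow_const _

theorem SamplePair.map_real_size_lt {Ω : Type*} [MeasurableSpace Ω] {Q : Measure Ω}
    {κ : Ω → SamplePair} (hκ : AEMeasurable κ Q) (r : ℕ) :
    (Q.map κ).real {c | c.1 < r} = Q.real {ω | (κ ω).1 < r} :=
  map_measureReal_apply_of_aemeasurable hκ
    (measurable_fst measurableSet_Iio : MeasurableSet {c : SamplePair | c.1 < r})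

section ReferenceSample

variable {Ω' : Type*} [MeasurableSpace Ω'] {P' : Measure Ω'} {E : Fin 2 → ℕ → Ω' → ℝ}
  {Z : Ω' → ℝ}

/-- Two samples of random size `⌊Z t⌋`, given by Rényi's representation of the order statistics of
exponential samples and centred by `log t`. -/
noncomputable def renyiSample (E : Fin 2 → ℕ → Ω' → ℝ) (Z : Ω' → ℝ) (t : ℝ≥0) (ω : Ω') :
    SamplePair :=
  (⌊Z ω * t⌋₊, fun c i => -Real.log t + ∑ l ∈ Finset.Ico i ⌊Z ω * t⌋₊, E c l ω / ((l : ℝ) + 1))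

theorem aemeasurable_floor_mul (hZ : AEMeasurable Z P') (t : ℝ≥0) :
    AEMeasurable (fun ω => ⌊Z ω * t⌋₊) P' :=
  Nat.measurable_floor.comp_aemeasurable (hZ.mul_const _)

theorem aemeasurable_renyiSample (hE : ∀ i j, AEMeasurable (E i j) P') (hZ : AEMeasurable Z P')
    (t : ℝ≥0) : AEMeasurable (renyiSample E Z t) P' := by
  have hG : Measurable fun z : (Fin 2 × ℕ → ℝ) × ℕ => ((z.2, fun c i =>
      -Real.log t + ∑ l ∈ Finset.Ico i z.2, z.1 (c, l) / ((l : ℝ) + 1)) : SamplePair) := by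
    refine measurable_from_prod_countable_left fun n => ?_
    simp only
    fun_prop
  exact hG.comp_aemeasurable ((aemeasurable_pi_lambda
    (fun ω (ij : Fin 2 × ℕ) => E ij.1 ij.2 ω) fun ij => hE ij.1 ij.2).prodMk
    (aemeasurable_floor_mul hZ t))

/-- The limit of the largest values of the reference samples. -/
noncomputable def topLimit (r : ℕ) (E : Fin 2 → ℕ → Ω' → ℝ) (Z : Ω' → ℝ) (ω : Ω')
    (i : Fin 2 × Fin r) : ℝ :=
  tailSum (fun j => E i.1 j ω) i.2 + Real.log (Z ω) + eulerMinusHarmonic i.2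

variable [IsProbabilityMeasure P']

theorem tendstoInDistribution_floor_mul_div (hZm : AEMeasurable Z P') (hZ : ∀ᵐ ω ∂P', 0 < Z ω) :
    TendstoInDistribution (fun (t : ℝ≥0) ω => (⌊Z ω * t⌋₊ : ℝ) / (t : ℝ)) atTop Z
      (fun _ => P') P' := by
  refine tendstoInDistribution_of_ae_tendsto (fun t => ?_) hZm ?_
  · exact (measurable_from_top (f := fun n : ℕ => (n : ℝ) / (t : ℝ))).comp_aemeasurable
      (aemeasurable_floor_mul hZm t)
  · filter_upwards [hZ] with ω hω
    exact (tendsto_nat_floor_mul_div_atTop hω.le).comp (NNReal.tendsto_coe_atTop.2 tendsto_id)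

theorem ae_forall_exists_tendsto_tailPartialSum (hE : ∀ i j, HasLaw (E i j) (expMeasure 1) P')
    (hi : iIndepFun (fun ij : Fin 2 × ℕ => E ij.1 ij.2) P') :
    ∀ᵐ ω ∂P', ∀ c, ∃ s, Tendsto (tailPartialSum (fun j => E c j ω) 0) atTop (𝓝 s) :=
  ae_all_iff.2 fun c => ae_exists_tendsto_tailPartialSum (hE c)
    (hi.precomp (g := fun j : ℕ => (c, j)) fun _ _ h => (Prod.ext_iff.1 h).2)

theorem aemeasurable_tailSum (hE : ∀ i j, HasLaw (E i j) (expMeasure 1) P')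
    (hi : iIndepFun (fun ij : Fin 2 × ℕ => E ij.1 ij.2) P') (c : Fin 2) (p : ℕ) :
    AEMeasurable (fun ω => tailSum (fun j => E c j ω) p) P' := by
  refine aemeasurable_of_tendsto_metrizable_ae atTop (f := fun n ω =>
    tailPartialSum (fun j => E c j ω) p n) (fun n => ?_) ?_
  · unfold tailPartialSum
    have : ∀ j, AEMeasurable (E c j) P' := fun j => (hE c j).aemeasurable
    fun_prop
  · filter_upwards [ae_forall_exists_tendsto_tailPartialSum hE hi] with ω hω
    exact tendsto_tailPartialSum (hω c) p

/-- Since the exponentials are nonnegative, the Rényi points decrease in their index and are already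
sorted. One sequence `E` serves all `t`, so convergence is even almost sure. -/
theorem tendstoInDistribution_topStats_renyiSample (r : ℕ)
    (hE : ∀ i j, HasLaw (E i j) (expMeasure 1) P')
    (hi : iIndepFun (fun ij : Fin 2 × ℕ => E ij.1 ij.2) P') (hZm : AEMeasurable Z P')
    (hZ : ∀ᵐ ω ∂P', 0 < Z ω) :
    TendstoInDistribution (fun t ω => SamplePair.topStats r (renyiSample E Z t ω)) atTop
      (topLimit r E Z) (fun _ => P') P' := by
  refine tendstoInDistribution_of_ae_tendsto (fun t =>
    (SamplePair.measurable_topStats r).comp_aemeasurable (aemeasurable_renyiSample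
      (fun i j => (hE i j).aemeasurable) hZm t)) ?_ ?_
  · refine aemeasurable_pi_lambda _ fun i => ?_
    exact ((aemeasurable_tailSum hE hi i.1 i.2).add
      (Real.measurable_log.comp_aemeasurable hZm)).add_const _
  · have hnn : ∀ᵐ ω ∂P', ∀ c j, 0 ≤ E c j ω := by
      refine ae_all_iff.2 fun c => ae_all_iff.2 fun j => ?_
      have := ae_expMeasure_one_nonneg
      rw [← (hE c j).map_eq] at this
      exact ae_of_ae_map (hE c j).aemeasurable this
    filter_upwards [hZ, hnn, ae_forall_exists_tendsto_tailPartialSum hE hi] with ω hz hE0 hs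
    refine tendsto_pi_nhds.2 fun i => (tendsto_sum_Ico_sub_log (hs i.1) hz i.2).congr' ?_
    have hn : Tendsto (fun t : ℝ≥0 => ⌊Z ω * t⌋₊) atTop atTop :=
      tendsto_nat_floor_atTop.comp
        ((NNReal.tendsto_coe_atTop.2 tendsto_id).const_mul_atTop hz)
    filter_upwards [hn.eventually (eventually_ge_atTop r)] with t ht
    have h1 := orderStat_of_antitone (x := (renyiSample E Z t ω).2 i.1) (i.2.2.trans_le ht)
      (fun a b hab _ => add_le_add le_rfl (Finset.sum_le_sum_of_subset_of_nonneg
        (Finset.Ico_subset_Ico_left hab) fun l _ _ => div_nonneg (hE0 _ _) (by positivity)))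
    exact h1.symm

/-- In expected weights the reference sample behaves like an iid sample from the product law of
`hasGumbelTails_exp`, despite its sorted, dependent points. -/
theorem integral_weight_renyiSample (hE : ∀ i j, HasLaw (E i j) (expMeasure 1) P')
    (hi : iIndepFun (fun ij : Fin 2 × ℕ => E ij.1 ij.2) P') (hZm : AEMeasurable Z P')
    (hEZ : IndepFun Z (fun ω (ij : Fin 2 × ℕ) => E ij.1 ij.2 ω) P') {m : ℕ} (x : Fin m → ℝ)
    (e : Fin 2 × Fin m → ℕ) (t : ℝ≥0) :
    ∫ ω, SamplePair.weight x e (renyiSample E Z t ω) ∂P'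
      = ∫ ω, (∫ z, levelWeight x (fun k => e (0, k)) z.1 * levelWeight x (fun k => e (1, k)) z.2
          ∂(((expMeasure 1).map (fun y => y - Real.log t)).prod
            ((expMeasure 1).map (fun y => y - Real.log t)))) ^ ⌊Z ω * t⌋₊ ∂P' := by
  have hfl : Measurable fun z : ℝ => ⌊z * t⌋₊ := Nat.measurable_floor.comp (by fun_prop)
  have h := integral_prod_two_renyi_random hE hi (aemeasurable_floor_mul hZm t)
    (hEZ.comp hfl measurable_id) (f := fun c => levelWeight x fun k => e (c, k))
    (fun c => measurable_levelWeight _ _) (fun c => abs_levelWeight_le_one _ _)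
    (fun c => countable_not_continuousAt_levelWeight _ _) (-Real.log t)
  have h2 : ∀ c, ∫ y, levelWeight x (fun k => e (c, k)) y
      ∂((expMeasure 1).map (fun y => y - Real.log t))
      = ∫ y, levelWeight x (fun k => e (c, k)) (-Real.log t + y) ∂(expMeasure 1) := fun c => by
    rw [integral_map (by fun_prop) (measurable_levelWeight _ _).aestronglyMeasurable]
    simp only [sub_eq_neg_add]
  rw [integral_prod_mul (levelWeight x fun k => e (0, k)) (levelWeight x fun k => e (1, k)), h2, h2]
  exact h

end ReferenceSample

/-! ### The claims and their comparison with the reference -/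

section ClaimSample

variable {Ω : Type*} [MeasurableSpace Ω] {P : Measure Ω} {X Y : ℕ → Ω → ℝ} {N : Ω → ℕ}
  {a₁ b₁ a₂ b₂ : ℝ}

/-- The normalised claims of both kinds. -/
noncomputable def claimSample (X Y : ℕ → Ω → ℝ) (N : Ω → ℕ) (a₁ b₁ a₂ b₂ : ℝ) (ω : Ω) :
    SamplePair :=
  (N ω, ![fun i => (X i ω - b₁) / a₁, fun i => (Y i ω - b₂) / a₂])

theorem aemeasurable_claimSample (hX : ∀ n, AEMeasurable (X n) P) (hY : ∀ n, AEMeasurable (Y n) P)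
    (hN : AEMeasurable N P) : AEMeasurable (claimSample X Y N a₁ b₁ a₂ b₂) P := by
  refine hN.prodMk (aemeasurable_pi_lambda _ fun c => aemeasurable_pi_lambda _ fun i => ?_)
  have := hX i
  have := hY i
  fin_cases c
  · simp only [Fin.zero_eta, Matrix.cons_val_zero]; fun_prop
  · simp only [Fin.mk_one, Matrix.cons_val_one]; fun_prop

theorem integral_weight_claimSample [IsProbabilityMeasure P] {ν : Measure (ℝ × ℝ)}
    (hlaw : ∀ n, HasLaw (fun ω => (X n ω, Y n ω)) ν P)
    (hiid : iIndepFun (fun n ω => (X n ω, Y n ω)) P) (hN : AEMeasurable N P)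
    (hindep : IndepFun N (fun ω n => (X n ω, Y n ω)) P) {m : ℕ} (x : Fin m → ℝ)
    (e : Fin 2 × Fin m → ℕ) :
    ∫ ω, SamplePair.weight x e (claimSample X Y N a₁ b₁ a₂ b₂ ω) ∂P
      = ∫ ω, (∫ z, levelWeight x (fun k => e (0, k)) z.1 * levelWeight x (fun k => e (1, k)) z.2
          ∂(ν.map fun z => ((z.1 - b₁) / a₁, (z.2 - b₂) / a₂))) ^ N ω ∂P := by
  have hf : Measurable fun z : ℝ × ℝ => levelWeight x (fun k => e (0, k)) z.1 *
      levelWeight x (fun k => e (1, k)) z.2 :=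
    ((measurable_levelWeight _ _).comp measurable_fst).mul
      ((measurable_levelWeight _ _).comp measurable_snd)
  have hm : Measurable fun z : ℝ × ℝ => ((z.1 - b₁) / a₁, (z.2 - b₂) / a₂) := by fun_prop
  rw [integral_map hm.aemeasurable hf.aestronglyMeasurable]
  refine integral_prod_range_random hlaw hiid hN hindep (hf.comp hm) fun z => ?_
  simp only [Function.comp]
  rw [abs_mul]
  exact mul_le_one₀ (abs_levelWeight_le_one _ _ _) (abs_nonneg _) (abs_levelWeight_le_one _ _ _)

end ClaimSample

section Main

variable {Ω Ω' : Type*} [MeasurableSpace Ω] [MeasurableSpace Ω']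
    {P : Measure Ω} [IsProbabilityMeasure P] {P' : Measure Ω'} [IsProbabilityMeasure P']
    {X Y : ℕ → Ω → ℝ} {ν : Measure (ℝ × ℝ)} {a₁ b₁ a₂ b₂ : ℝ → ℝ} {N : ℝ≥0 → Ω → ℕ}
    {Z : Ω' → ℝ} {E : Fin 2 → ℕ → Ω' → ℝ}

/-- The normalised largest claims of both kinds converge jointly in distribution. -/
theorem tendstoInDistribution_topStats_claimSample (r : ℕ)
    (hlaw : ∀ n, HasLaw (fun ω => (X n ω, Y n ω)) ν P)
    (hiid : iIndepFun (fun n ω => (X n ω, Y n ω)) P)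
    (hMDA : IsInMDA (bivariateCDF ν) gumbelProduct a₁ b₁ a₂ b₂)
    (hN : ∀ t, AEMeasurable (N t) P)
    (hindep : ∀ t, IndepFun (N t) (fun ω n => (X n ω, Y n ω)) P)
    (hZ : ∀ᵐ ω ∂P', 0 < Z ω)
    (hNZ : TendstoInDistribution (fun (t : ℝ≥0) ω => (N t ω : ℝ) / (t : ℝ)) atTop Z
      (fun _ => P) P')
    (hE : ∀ i j, HasLaw (E i j) (expMeasure 1) P')
    (hi : iIndepFun (fun (ij : Fin 2 × ℕ) => E ij.1 ij.2) P')
    (hEZ : IndepFun Z (fun ω (ij : Fin 2 × ℕ) => E ij.1 ij.2 ω) P') :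
    TendstoInDistribution (fun (t : ℝ≥0) ω => SamplePair.topStats r
        (claimSample X Y (N t) (a₁ t) (b₁ t) (a₂ t) (b₂ t) ω)) atTop
      (topLimit r E Z) (fun _ => P) P' := by
  have hν : IsProbabilityMeasure ν := by
    rw [← (hlaw 0).map_eq]; exact Measure.isProbabilityMeasure_map (hlaw 0).aemeasurable
  have hX : ∀ n, AEMeasurable (X n) P := fun n => (hlaw n).aemeasurable.fst
  have hY : ∀ n, AEMeasurable (Y n) P := fun n => (hlaw n).aemeasurable.snd
  have hZm := hNZ.aemeasurable_limit
  have href := tendstoInDistribution_topStats_renyiSample r hE hi hZm hZ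
  have hfloor := tendstoInDistribution_floor_mul_div hZm hZ
  have hcm : ∀ t : ℝ≥0, AEMeasurable (claimSample X Y (N t) (a₁ t) (b₁ t) (a₂ t) (b₂ t)) P :=
    fun t => aemeasurable_claimSample hX hY (hN t)
  have hrm : ∀ t : ℝ≥0, AEMeasurable (renyiSample E Z t) P' := fun t =>
    aemeasurable_renyiSample (fun i j => (hE i j).aemeasurable) hZm t
  refine ⟨fun t => (SamplePair.measurable_topStats r).comp_aemeasurable (hcm t),
    href.aemeasurable_limit, tendsto_iff_forall_lipschitz_integral_tendsto.2 ?_⟩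
  rintro h ⟨C, hC⟩ ⟨K, hK⟩
  have hbd : ∀ w, |h w| ≤ C + |h 0| := fun w => by
    have := hC w 0
    rw [Real.dist_eq] at this
    have := abs_sub_abs_le_abs_sub (h w) (h 0)
    linarith
  have hlimpr := Measure.isProbabilityMeasure_map href.aemeasurable_limit
  have key := SamplePair.tendsto_integral_topStats (l := atTop)
    (μ := fun t : ℝ≥0 => P.map (claimSample X Y (N t) (a₁ t) (b₁ t) (a₂ t) (b₂ t)))
    (μ' := fun t : ℝ≥0 => P'.map (renyiSample E Z t))
    (fun t => Measure.isProbabilityMeasure_map (hcm t))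
    (fun t => Measure.isProbabilityMeasure_map (hrm t))
    (fun m x e => by
      -- The same `L` is used for both families, so both expected weights tend to `E exp(-L Z)` and
      -- their difference to 0.
      obtain ⟨L, hL⟩ := exists_tendsto_mul_one_sub_integral x (fun k => e (0, k))
        (fun k => e (1, k))
      have hle : ∀ (ν₀ : Measure (ℝ × ℝ)) [IsProbabilityMeasure ν₀],
          ∫ z, levelWeight x (fun k => e (0, k)) z.1 * levelWeight x (fun k => e (1, k)) z.2 ∂ν₀
            ≤ 1 := by
        intro ν₀ _
        refine (Real.le_norm_self _).trans ((norm_integral_le_of_norm_le_const (C := 1)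
          (ae_of_all _ fun z => ?_)).trans (by simp))
        rw [norm_mul]
        exact mul_le_one₀ (abs_levelWeight_le_one _ _ _) (norm_nonneg _)
          (abs_levelWeight_le_one _ _ _)
      have g1 := tendsto_integral_pow_random hZ hNZ
        (fun t => @hle _ (hMDA.hasGumbelTails.isProbabilityMeasure t)) (hL _ hMDA.hasGumbelTails)
      have g2 := tendsto_integral_pow_random hZ hfloor
        (fun t => @hle _ (hasGumbelTails_exp.isProbabilityMeasure t)) (hL _ hasGumbelTails_exp)
      have := g1.sub g2
      rw [sub_self] at this
      refine this.congr fun t => ?_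
      rw [integral_map (hcm t) (SamplePair.measurable_weight x e).aestronglyMeasurable,
        integral_map (hrm t) (SamplePair.measurable_weight x e).aestronglyMeasurable,
        integral_weight_claimSample hlaw hiid (hN t) (hindep t),
        integral_weight_renyiSample hE hi hZm hEZ])
    ((tendsto_measureReal_random_lt hZ hN hNZ r).congr fun t => (SamplePair.map_real_size_lt (hcm t) r).symm)
    ((tendsto_measureReal_random_lt hZ (aemeasurable_floor_mul hZm) hfloor r).congr
      fun t => (SamplePair.map_real_size_lt (hrm t) r).symm)
    (P'.map (topLimit r E Z))
    (fun f hf ⟨D, hD⟩ => by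
      rw [integral_map href.aemeasurable_limit hf.measurable.aestronglyMeasurable]
      refine (href.tendsto_integral hf hD).congr fun t => ?_
      exact (integral_map (hrm t)
        (hf.measurable.comp (SamplePair.measurable_topStats r)).aestronglyMeasurable).symm)
    hbd hK
  simp only [ProbabilityMeasure.coe_mk]
  refine key.congr fun t => ?_
  exact (integral_map (hcm t) (hK.continuous.measurable.comp
    (SamplePair.measurable_topStats r)).aestronglyMeasurable).trans (integral_map
    ((SamplePair.measurable_topStats r).comp_aemeasurable (hcm t))
    hK.continuous.measurable.aestronglyMeasurable).symm

end Main

/-! ### From largest values to treaties -/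

/-- The linear combination of the first `p` largest values of the sample `c`. -/
def topCombination {r : ℕ} (k : ℕ → ℝ) (p : ℕ) (c : Fin 2) (w : Fin 2 × Fin r → ℝ) : ℝ :=
  ∑ j ∈ Finset.range p, k j * if h : j < r then w (c, ⟨j, h⟩) else 0

theorem continuous_topCombination {r : ℕ} (k : ℕ → ℝ) (p : ℕ) (c : Fin 2) :
    Continuous (topCombination (r := r) k p c) := by
  refine continuous_finsetSum _ fun j _ => continuous_const.mul ?_
  by_cases h : j < r
  · simp only [h, dite_true]; fun_prop
  · simp only [h, dite_false]; fun_prop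

theorem topCombination_topLimit {Ω' : Type*} {E : Fin 2 → ℕ → Ω' → ℝ} {Z : Ω' → ℝ} {ω : Ω'}
    {c : Fin 2} (h : ∃ s, Tendsto (tailPartialSum (fun j => E c j ω) 0) atTop (𝓝 s)) (k : ℕ → ℝ)
    {p r : ℕ} (hp : p ≤ r) :
    topCombination k p c (topLimit r E Z ω) = treatyLimit k p (fun j => E c j ω) (Z ω) := by
  rw [treatyLimit_eq_sum h]
  refine Finset.sum_congr rfl fun j hj => ?_
  rw [dif_pos ((Finset.mem_range.1 hj).trans_le hp)]
  rfl

/-- The condition `r ≤ n` is essential: a missing order statistic is 0 both before and after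
normalisation, which does not commute with the affine map. -/
theorem topCombination_affine (x : ℕ → ℝ) {a : ℝ} (ha : 0 < a) (b : ℝ) (k : ℕ → ℝ) {p r n : ℕ}
    (hp : p ≤ r) (hn : r ≤ n) {c : Fin 2} {s : SamplePair} (hs : s.1 = n)
    (hx : s.2 c = fun i => (x i - b) / a) :
    topCombination k p c (SamplePair.topStats r s) = (linearTreaty k p x n - b * coeffSum k p) / a := by
  rw [linearTreaty, coeffSum, Finset.mul_sum, ← Finset.sum_sub_distrib, Finset.sum_div]
  refine Finset.sum_congr rfl fun j hj => ?_
  have hjp := Finset.mem_range.1 hj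
  rw [dif_pos (hjp.trans_le hp), SamplePair.topStats, hs, hx,
    orderStat_affine x (by simp only; omega) ha]
  ring

theorem measurable_linearTreaty (k : ℕ → ℝ) (p : ℕ) :
    Measurable fun z : (ℕ → ℝ) × ℕ => linearTreaty k p z.1 z.2 := by
  refine measurable_from_prod_countable_left fun n => ?_
  exact Finset.measurable_fun_sum _ fun j _ => (measurable_orderStat_sub n j).const_mul _

theorem proposition3p2
    {Ω Ω' : Type*} [MeasurableSpace Ω] [MeasurableSpace Ω']
    (P : Measure Ω) [IsProbabilityMeasure P] (P' : Measure Ω') [IsProbabilityMeasure P']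
    -- iid claim sizes with common law `ν`
    (X Y : ℕ → Ω → ℝ) (ν : Measure (ℝ × ℝ))
    (hlaw : ∀ n, HasLaw (fun ω => (X n ω, Y n ω)) ν P)
    (hiid : iIndepFun (fun n ω => (X n ω, Y n ω)) P)
    -- the max-domain of attraction condition
    (a₁ b₁ a₂ b₂ : ℝ → ℝ)
    (hMDA : IsInMDA (bivariateCDF ν) gumbelProduct a₁ b₁ a₂ b₂)
    -- the number of claims, independent of the claim sizes
    (N : ℝ≥0 → Ω → ℕ) (hN : ∀ t, Measurable (N t))
    (hindep : ∀ t, IndepFun (N t) (fun ω n => (X n ω, Y n ω)) P)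
    -- convergence in distribution of `N(t)/t` to the almost surely positive `Z`
    (Z : Ω' → ℝ) (hZ : ∀ᵐ ω ∂P', 0 < Z ω)
    (hNZ : TendstoInDistribution (fun (t : ℝ≥0) ω => (N t ω : ℝ) / (t : ℝ)) atTop Z
      (fun _ => P) P')
    -- iid unit exponentials, independent of `Z`
    (E : Fin 2 → ℕ → Ω' → ℝ)
    (hElaw : ∀ i j, HasLaw (E i j) (expMeasure 1) P')
    (hEiid : iIndepFun (fun (ij : Fin 2 × ℕ) => E ij.1 ij.2) P')
    (hEZ : IndepFun Z (fun ω (ij : Fin 2 × ℕ) => E ij.1 ij.2 ω) P')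
    -- the coefficients of the two treaties
    (p q : ℕ) (hp : 1 ≤ p) (hq : 1 ≤ q) (k₁ k₂ : ℕ → ℝ) :
    -- the two series converge almost surely
    (∀ᵐ ω ∂P', Tendsto (tailPartialSum (fun j => E 0 j ω) p) atTop
      (𝓝 (tailSum (fun j => E 0 j ω) p))) ∧
    (∀ᵐ ω ∂P', Tendsto (tailPartialSum (fun j => E 1 j ω) q) atTop
      (𝓝 (tailSum (fun j => E 1 j ω) q))) ∧
    -- and the normalised pair of treaties converges in distribution
    TendstoInDistribution
      (fun (t : ℝ≥0) ω =>
        ((linearTreaty k₁ p (fun n => X n ω) (N t ω) - b₁ t * coeffSum k₁ p) / a₁ t,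
         (linearTreaty k₂ q (fun n => Y n ω) (N t ω) - b₂ t * coeffSum k₂ q) / a₂ t))
      atTop
      (fun ω => (treatyLimit k₁ p (fun j => E 0 j ω) (Z ω),
        treatyLimit k₂ q (fun j => E 1 j ω) (Z ω)))
      (fun _ => P) P' := by
  have hE0 := ae_forall_exists_tendsto_tailPartialSum hElaw hEiid
  refine ⟨hE0.mono fun ω h => tendsto_tailPartialSum (h 0) p,
    hE0.mono fun ω h => tendsto_tailPartialSum (h 1) q, ?_⟩
  have hX : ∀ n, AEMeasurable (X n) P := fun n => (hlaw n).aemeasurable.fst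
  have hY : ∀ n, AEMeasurable (Y n) P := fun n => (hlaw n).aemeasurable.snd
  set r := max p q
  let g : (Fin 2 × Fin r → ℝ) → ℝ × ℝ := fun w => (topCombination k₁ p 0 w, topCombination k₂ q 1 w)
  have hg : Continuous g := (continuous_topCombination k₁ p 0).prodMk
    (continuous_topCombination k₂ q 1)
  have htop := (tendstoInDistribution_topStats_claimSample r hlaw hiid hMDA
    (fun t => (hN t).aemeasurable) hindep hZ hNZ hElaw hEiid hEZ).continuous_comp hg
  have htop' := htop.congr (fun t => EventuallyEq.rfl) (T := fun ω =>
    (treatyLimit k₁ p (fun j => E 0 j ω) (Z ω), treatyLimit k₂ q (fun j => E 1 j ω) (Z ω)))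
    (hE0.mono fun ω h => Prod.ext (topCombination_topLimit (h 0) k₁ (le_max_left p q))
      (topCombination_topLimit (h 1) k₂ (le_max_right p q)))
  have hcoe : Tendsto (fun t : ℝ≥0 => (t : ℝ)) atTop atTop := NNReal.tendsto_coe_atTop.2 tendsto_id
  -- For large `t` the norming constants are positive, and the treaty pair agrees exactly with the
  -- continuous image of the largest values unless `N t < r`. The difference therefore tends to 0 in
  -- measure.
  refine tendstoInDistribution_of_tendstoInMeasure_sub _ _ htop' ?_ fun t => ?_
  · intro ε hε
    have hsmall := tendsto_measureReal_random_lt hZ (fun t => (hN t).aemeasurable) hNZ r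
    have hsmall' : Tendsto (fun t => P {ω | N t ω < r}) atTop (𝓝 0) := by
      rw [← ENNReal.tendsto_toReal_iff (fun t => measure_ne_top _ _) ENNReal.zero_ne_top]
      exact hsmall
    refine tendsto_of_tendsto_of_tendsto_of_le_of_le' tendsto_const_nhds hsmall'
      (Eventually.of_forall fun _ => zero_le) ?_
    filter_upwards [hcoe.eventually hMDA.1, hcoe.eventually hMDA.2.1] with t ha₁ ha₂
    refine measure_mono fun ω hω => ?_
    by_contra hlt
    refine (lt_of_lt_of_le hε hω).ne' ?_
    have hr : r ≤ N t ω := not_lt.1 hlt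
    have e1 := topCombination_affine (r := r) (fun n => X n ω) ha₁ (b₁ t) k₁ (le_max_left p q) hr (c := 0)
      (s := claimSample X Y (N t) (a₁ t) (b₁ t) (a₂ t) (b₂ t) ω) rfl rfl
    have e2 := topCombination_affine (r := r) (fun n => Y n ω) ha₂ (b₂ t) k₂ (le_max_right p q) hr (c := 1)
      (s := claimSample X Y (N t) (a₁ t) (b₁ t) (a₂ t) (b₂ t) ω) rfl rfl
    simp only [Pi.sub_apply, Pi.zero_apply, Function.comp, g]
    rw [e1, e2, sub_self, edist_self]
  · have m1 := (measurable_linearTreaty k₁ p).comp_aemeasurable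
      ((aemeasurable_pi_lambda (fun ω n => X n ω) hX).prodMk (hN t).aemeasurable)
    have m2 := (measurable_linearTreaty k₂ q).comp_aemeasurable
      ((aemeasurable_pi_lambda (fun ω n => Y n ω) hY).prodMk (hN t).aemeasurable)
    exact ((m1.sub_const _).div_const _).prodMk ((m2.sub_const _).div_const _)
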